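/- **Theorem 4.1 (Conditional equivalence, rotating case).** Let $d\ge 1$, $1<p<\infty$, and $p<\frac{d+2}{d-2}$ if $d\ge3$. Let $V:\mathbb R^d\to[0,\infty)$ be measurable with $V(\mathbf x)\to\infty$ as $|\mathbf x|\to\infty$. Put $L_z=i(x_2\partial_{x_1}-x_1\partial_{x_2})$ if $d\ge2$ and $L_z=0$ if $d=1$, and $$\Omega_{\max}:=\sup\Big\{\gamma>0:\ \lim_{|\mathbf x|\to\infty}\Big(V(\mathbf x)-\tfrac{\gamma^2}{2}(x_1^2+x_2^2)\Big)=\infty\Big\}\le\infty,$$ where $x_1^2+x_2^2$ is read as $0$ if $d=1$ (there is no rotation term then). Let $\Omega\in\mathbb R$ with $0<|\Omega|<\Omega_{\max}$. Let $X:=\{\phi\in H^1(\mathbb R^d;\mathbb C):\int_{\mathbb R^d} V|\phi|^2\,d\mathbf x<\infty\}$ and, for $\phi\in X$ and $\omega\in\mathbb R$, $$E(\phi):=\int_{\mathbb R^d}\Big(\tfrac12|\nabla\phi|^2+V|\phi|^2+\tfrac{2}{p+1}|\phi|^{p+1}-\Omega\,\overline\phi L_z\phi\Big)d\mathbf x,\qquad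 S_{\Omega,\omega}(\phi):=E(\phi)+\omega\|\phi\|_{L^2}^2,$$ $$\lambda_0(\Omega):=\inf_{0\ne\phi\in X}\frac{\int_{\mathbb R^d}\big(\frac12|\nabla\phi|^2+V|\phi|^2-\Omega\,\overline\phi L_z\phi\big)d\mathbf x}{\|\phi\|_{L^2}^2}.$$ Let $\mathcal A_{\Omega,\omega}$ (the action ground states for $\omega$) be the set of minimizers of $S_{\Omega,\omega}$ among all weak solutions $\phi\in X\setminus\{0\}$ of $$-\tfrac12\Delta\phi+V\phi+|\phi|^{p-1}\phi-\Omega L_z\phi+\omega\phi=0,$$ the equation being tested against all elements of $X$. For $m>0$ let $\mathcal B_{\Omega,m}$ (the energy ground states of mass $m$) be the set of minimizers of $E$ among all $\phi\in X$ with $\|\phi\|_{L^2}^2=m$. Finally let $\mathcal N_{\Omega,\omega}:=\{\|\phi\|_{L^2}^2:\phi\in\mathcal A_{\Omega,\omega}\}$. Let $\omega<-\lambda_0(\Omega)$. Then every $\phi\in\mathcal A_{\Omega,\omega}$ is an energy ground state of mass $m=\|\phi\|_{L^2}^2$, and every energy ground state of precisely this mass $m$ belongs to $\mathcal A_{\Omega,\omega}$.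 Moreover, $$\mathcal A_{\Omega,\omega}=\bigcup_{m\in\mathcal N_{\Omega,\omega}}\mathcal B_{\Omega,m}.$$ -/

import Mathlib

open MeasureTheory Filter
open scoped SchwartzMap LineDeriv ComplexConjugate

noncomputable section

namespace RotNLS

/-- The Euclidean space `ℝᵈ`. -/
abbrev Pt (d : ℕ) := EuclideanSpace ℝ (Fin d)

/-- The complex Hilbert space `L²(ℝᵈ)` of classes of functions up to a.e. equality. -/
abbrev L2 (d : ℕ) := Lp ℂ 2 (volume : Measure (Pt d))

/-- `g ∈ L²` is the weak derivative `∂u/∂xᵢ` of `u ∈ L²`: the derivative of `u` in the sense of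
(tempered) distributions in the direction of the `i`-th unit vector is represented by `g`. -/
def HasWeakPartial {d : ℕ} (i : Fin d) (u g : L2 d) : Prop :=
  ∂_{(EuclideanSpace.single i (1 : ℝ) : Pt d)} (u : 𝓢'(Pt d, ℂ)) = (g : 𝓢'(Pt d, ℂ))

/-- Weak derivatives are unique. -/
theorem HasWeakPartial.unique {d : ℕ} {i : Fin d} {u g g' : L2 d}
    (h : HasWeakPartial i u g) (h' : HasWeakPartial i u g') : g = g' := by
  have hk := Lp.ker_toTemperedDistributionCLM_eq_bot (F := ℂ) (p := 2)
    (μ := (volume : Measure (Pt d)))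
  have : Lp.toTemperedDistributionCLM ℂ (volume : Measure (Pt d)) 2 g
      = Lp.toTemperedDistributionCLM ℂ (volume : Measure (Pt d)) 2 g' := by
    simpa [HasWeakPartial] using h.symm.trans h'
  exact LinearMap.ker_eq_bot.mp hk this

/-- The Sobolev space `H¹(ℝᵈ)`. -/
def H1 (d : ℕ) : Set (L2 d) :=
  {u | ∀ i : Fin d, ∃ g : L2 d, HasWeakPartial i u g}

open Classical in
/-- The weak partial derivative `∂ᵢu ∈ L²` (it is used for `u ∈ H¹` only; `0` if `u` has no weak
partial derivative in `L²`). -/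
def weakPartial {d : ℕ} (i : Fin d) (u : L2 d) : L2 d :=
  if h : ∃ g : L2 d, HasWeakPartial i u g then h.choose else 0

theorem weakPartial_eq {d : ℕ} {i : Fin d} {u g : L2 d} (h : HasWeakPartial i u g) :
    weakPartial i u = g := by
  have hex : ∃ g : L2 d, HasWeakPartial i u g := ⟨g, h⟩
  rw [weakPartial, dif_pos hex]
  exact hex.choose_spec.unique h

/-- The energy space `X = H¹(ℝᵈ) ∩ L²_V(ℝᵈ)`. -/
def X {d : ℕ} (V : Pt d → ℝ) : Set (L2 d) :=
  {u | u ∈ H1 d ∧ Integrable (fun x => V x * ‖u x‖ ^ 2) volume}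

/-- The angular momentum `L_z u = i (x₂ ∂₁u - x₁ ∂₂u)` if `d ≥ 2`, and `L_z u = 0` if `d = 1`. -/
def Lz {d : ℕ} (u : L2 d) (x : Pt d) : ℂ :=
  if h : 2 ≤ d then
    Complex.I * ((x ⟨1, by omega⟩ : ℂ) * weakPartial ⟨0, by omega⟩ u x
      - (x ⟨0, by omega⟩ : ℂ) * weakPartial ⟨1, by omega⟩ u x)
  else 0

/-- `x₁² + x₂²`, the squared distance to the rotation axis, if `d ≥ 2`; in dimension one, where
there is no rotation term, it is `0`. -/
def axisDistSq {d : ℕ} (x : Pt d) : ℝ :=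
  if h : 2 ≤ d then x ⟨0, by omega⟩ ^ 2 + x ⟨1, by omega⟩ ^ 2 else 0

/-- The critical rotation speed `Ω_max ≤ ∞`: the supremum of all `γ > 0` such that
`V(x) - γ²/2 (x₁² + x₂²) → ∞` as `|x| → ∞`. -/
def OmegaMax {d : ℕ} (V : Pt d → ℝ) : EReal :=
  sSup {e : EReal | ∃ γ : ℝ, 0 < γ ∧ e = (γ : EReal) ∧
    Tendsto (fun x => V x - γ ^ 2 / 2 * axisDistSq x) (cocompact (Pt d)) atTop}

/-- The quadratic form `∫ (½ |∇u|² + V |u|² - Ω ū L_z u)` of the linear operator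
`-½ Δ + V - Ω L_z`; the integral of `ū L_z u` is real for every `u ∈ X`. -/
def linForm {d : ℕ} (V : Pt d → ℝ) (Ω : ℝ) (u : L2 d) : ℝ :=
  1 / 2 * (∑ i, ‖weakPartial i u‖ ^ 2) + (∫ x, V x * ‖u x‖ ^ 2)
    - Ω * (∫ x, conj (u x) * Lz u x).re

/-- `λ₀(Ω)`, the infimum of the Rayleigh quotient over `X \ {0}`. -/
def lambda0 {d : ℕ} (V : Pt d → ℝ) (Ω : ℝ) : ℝ :=
  sInf {r : ℝ | ∃ u ∈ X V, u ≠ 0 ∧ r = linForm V Ω u / ‖u‖ ^ 2}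

/-- The energy `E(u) = ½ ‖∇u‖² + ∫ V |u|² + 2/(p+1) ‖u‖_{p+1}^{p+1} - Ω ∫ ū L_z u`. -/
def energy {d : ℕ} (V : Pt d → ℝ) (p Ω : ℝ) (u : L2 d) : ℝ :=
  linForm V Ω u + 2 / (p + 1) * (∫ x, ‖u x‖ ^ (p + 1))

/-- The action `S_{Ω,ω}(u) = E(u) + ω ‖u‖²`. -/
def action {d : ℕ} (V : Pt d → ℝ) (p Ω ω : ℝ) (u : L2 d) : ℝ :=
  energy V p Ω u + ω * ‖u‖ ^ 2

/-- `u` is a weak solution of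
`-½ Δu + V u + |u|^{p-1} u - Ω L_z u + ω u = 0`, tested against every `v ∈ X`. -/
def IsStationary {d : ℕ} (V : Pt d → ℝ) (p Ω ω : ℝ) (u : L2 d) : Prop :=
  ∀ v ∈ X V,
    1 / 2 * (∑ i, ∫ x, weakPartial i u x * conj (weakPartial i v x))
      + (∫ x, (V x : ℂ) * u x * conj (v x))
      + (∫ x, ((‖u x‖ ^ (p - 1) : ℝ) : ℂ) * u x * conj (v x))
      - (Ω : ℂ) * (∫ x, Lz u x * conj (v x))
      + (ω : ℂ) * (∫ x, u x * conj (v x)) = 0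

/-- The non-trivial solutions in `X` of the stationary equation. -/
def nontrivialSolutions {d : ℕ} (V : Pt d → ℝ) (p Ω ω : ℝ) : Set (L2 d) :=
  {u | u ∈ X V ∧ u ≠ 0 ∧ IsStationary V p Ω ω u}

/-- The action ground states `𝒜_{Ω,ω}`: the minimizers of the action among all non-trivial
solutions of the stationary equation. -/
def actionGroundStates {d : ℕ} (V : Pt d → ℝ) (p Ω ω : ℝ) : Set (L2 d) :=
  {u | u ∈ nontrivialSolutions V p Ω ω ∧
    ∀ v ∈ nontrivialSolutions V p Ω ω, action V p Ω ω u ≤ action V p Ω ω v}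

/-- The energy ground states `ℬ_{Ω,m}` of mass `m > 0`: the minimizers of the energy among all
elements of `X` with squared `L²` norm `m`. -/
def energyGroundStates {d : ℕ} (V : Pt d → ℝ) (p Ω m : ℝ) : Set (L2 d) :=
  {u | 0 < m ∧ u ∈ X V ∧ ‖u‖ ^ 2 = m ∧
    ∀ v ∈ X V, ‖v‖ ^ 2 = m → energy V p Ω u ≤ energy V p Ω v}

/-- The set `𝒩_{Ω,ω}` of the masses of the action ground states. -/
def actionMasses {d : ℕ} (V : Pt d → ℝ) (p Ω ω : ℝ) : Set ℝ :=
  {m | ∃ u ∈ actionGroundStates V p Ω ω, m = ‖u‖ ^ 2}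

end RotNLS

end

/-!
For `ω < -λ₀(Ω)` the action ground states are global objects: each of them minimizes the action
over the whole energy space `X`, although it is only required to be optimal among the nontrivial
solutions of the stationary equation. Granted this, both assertions are short. On the functions of
mass `m` the action and the energy differ by the constant `ω m`, so an action ground state of mass
`m` minimizes the energy at that mass. Conversely an energy ground state of the same mass has at
most the same action, so it is itself a global minimizer of the action, hence a solution and an
action ground state.

Since a global minimizer of the action solves the stationary equation
(`SubcriticalRotation.isStationary_of_minimizer`), it suffices to produce one that is not zero.
The condition on `ω` makes the quadratic part of the action negative in some direction, and near
zero it dominates the nonlinearity (`SubcriticalRotation.exists_action_neg`), so the infimum of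
the action is negative and is not attained at zero. That it is attained is the direct method
(`SubcriticalRotation.exists_action_le`):

* For some `γ > |Ω|` the potential dominates `γ² / 2 (x₁² + x₂²)` up to a constant, so the kinetic
  and potential energies control the rotation term (`SubcriticalRotation.le_re_form`). The term
  `ω ‖u‖²`, which may be negative, is absorbed by the potential far away, and by the power
  `|u|^(p+1)` on a bounded set (`SubcriticalRotation.exists_le_action`).
* Bounded sets of `X` are relatively compact in `L²` (`exists_tendsto_subseq`). The growth of `V`
  makes the mass far away small, the bound on the gradient makes the high frequencies small, and
  the low frequencies converge pointwise along a weakly convergent subsequence.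
* Up to a multiple of the squared `L²` norm the action is uniformly convex
  (`SubcriticalRotation.action_midpoint_le`), because `|u|^(p+1)` is convex. So a minimizing
  sequence that converges in `L²` is a Cauchy sequence in the energy norm, the quadratic part
  converges, and Fatou's lemma handles the power.

Two facts of analysis enter. For subcritical `p` the function `|u|^(p+1)` is integrable for every
`u ∈ H¹` (`integrable_rpow_of_mem_H1`), so that the nonlinear part of the energy is finite and
differentiable along lines. It follows from a real interpolation argument that bounds the
superlevel set `{|u| > t}` by cutting `u` at the frequency for which the low-frequency part is at
most `t / 2`. And the angular momentum is a symmetric operator on `X`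
(`integral_rotation_eq_neg`), so that the quadratic form is Hermitian and the first variation of
the action is the weak form of the stationary equation. The integration by parts has no error term
if the cutoff is radial, as the rotation field annihilates radial functions.
-/

noncomputable section

namespace RotNLS

variable {d : ℕ}

section Form

open scoped FourierTransform Topology ENNReal RealInnerProductSpace ContDiff

/-! ### Weak derivatives and the Fourier transform -/

/-- For integrable functions in `L²`, the inverse Fourier transform of `L²` is given by the Fourier
integral. -/
theorem fourierInv_toLp_ae_eq {h : Pt d → ℂ} (h1 : Integrable h) (h2 : MemLp h 2) :
    (𝓕⁻ (h2.toLp h) : L2 d) =ᵐ[volume] 𝓕⁻ h := by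
  have hcont : Continuous (𝓕⁻ h) := by
    have : Continuous (𝓕 h) :=
      VectorFourier.fourierIntegral_continuous Real.continuous_fourierChar
        (by exact continuous_inner) h1
    have h' : 𝓕⁻ h = fun x => 𝓕 h (-x) := by
      ext x; exact Real.fourierInv_eq_fourier_neg h x
    rw [h']
    exact this.comp continuous_neg
  refine ae_eq_of_integral_contDiff_smul_eq ((Lp.memLp _).locallyIntegrable (by norm_num))
    hcont.locallyIntegrable ?_
  intro g hg hgc
  have hg₁ : HasCompactSupport (Complex.ofRealCLM ∘ g) := hgc.comp_left rfl
  have hg₂ : ContDiff ℝ ∞ (Complex.ofRealCLM ∘ g) := by fun_prop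
  set ψ : 𝓢(Pt d, ℂ) := hg₁.toSchwartzMap hg₂ with hψ
  have hψx : ∀ x, ψ x = (g x : ℂ) := fun x => rfl
  have e1 := congrArg (fun T : 𝓢'(Pt d, ℂ) => T ψ)
    (Lp.fourierInv_toTemperedDistribution_eq (h2.toLp h))
  simp only [TemperedDistribution.fourierInv_apply, Lp.toTemperedDistribution_apply] at e1
  simp only [hψx, smul_eq_mul] at e1
  calc _ = ∫ x, (g x : ℂ) * (𝓕⁻ (h2.toLp h) : L2 d) x := by simp
    _ = ∫ x, (𝓕⁻ ψ) x * h x := by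
        rw [← e1]; apply integral_congr_ae
        filter_upwards [h2.coeFn_toLp] with x hx
        rw [hx]
    _ = ∫ x, g x • 𝓕⁻ h x := by
        have := VectorFourier.integral_fourierIntegral_smul_eq_flip (L := -innerₗ (Pt d))
          Real.continuous_fourierChar (by
            exact (continuous_inner (𝕜 := ℝ) (E := Pt d)).neg) ψ.integrable h1
            (μ := volume) (ν := volume)
        have hf : (-innerₗ (Pt d)).flip = -innerₗ (Pt d) := by
          ext x y; simp [real_inner_comm]
        rw [hf] at this
        simpa [SchwartzMap.fourierInv_coe, hψx] using! this

/-- On the Fourier side a weak partial derivative is multiplication by `2πi ξᵢ`. -/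
theorem HasWeakPartial.fourier_ae_eq {i : Fin d} {u g : L2 d} (h : HasWeakPartial i u g) :
    (𝓕 g : L2 d) =ᵐ[volume] fun ξ => (2 * Real.pi * Complex.I) * (ξ i : ℂ) * (𝓕 u : L2 d) ξ := by
  have hli : LocallyIntegrable
      (fun ξ : Pt d => (2 * Real.pi * Complex.I) * (ξ i : ℂ) * (𝓕 u : L2 d) ξ) := by
    have := (((Lp.memLp (𝓕 u : L2 d)).locallyIntegrable (by norm_num)).locallyIntegrableOn
      Set.univ).continuousOn_mul
      (g := fun ξ : Pt d => (2 * Real.pi * Complex.I) * (ξ i : ℂ)) (by fun_prop)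
      isOpen_univ.isLocallyClosed
    simpa using locallyIntegrableOn_univ.mp this
  refine ae_eq_of_integral_contDiff_smul_eq ((Lp.memLp _).locallyIntegrable (by norm_num))
    hli ?_
  intro φ hg hgc
  have hg₁ : HasCompactSupport (Complex.ofRealCLM ∘ φ) := hgc.comp_left rfl
  have hg₂ : ContDiff ℝ ∞ (Complex.ofRealCLM ∘ φ) := by fun_prop
  set ψ : 𝓢(Pt d, ℂ) := hg₁.toSchwartzMap hg₂ with hψ
  have hψx : ∀ x, ψ x = (φ x : ℂ) := fun x => rfl
  have e0 := congrArg 𝓕 h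
  rw [TemperedDistribution.fourier_lineDerivOp_eq, Lp.fourier_toTemperedDistribution_eq,
    Lp.fourier_toTemperedDistribution_eq] at e0
  have e1 := congrArg (fun T : 𝓢'(Pt d, ℂ) => T ψ) e0
  have htg : (fun x : Pt d =>
      ((inner ℝ x (EuclideanSpace.single i (1 : ℝ)) : ℝ) : ℂ)).HasTemperateGrowth := by
    fun_prop
  simp [SchwartzMap.smulLeftCLM_apply_apply htg, hψx] at e1
  rw [← integral_const_mul] at e1
  calc _ = ∫ x, (φ x : ℂ) * (𝓕 g : L2 d) x := by simp
    _ = _ := by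
        rw [← e1]; congr 1; ext x; simp [EuclideanSpace.inner_single_right]; ring

/-- Integration by parts in `H¹`, which on the Fourier side says that `2πi ξᵢ` is imaginary. -/
theorem inner_weakPartial_left {i : Fin d} {u g v h : L2 d} (hu : HasWeakPartial i u g)
    (hv : HasWeakPartial i v h) : inner ℂ g v = - inner ℂ u h := by
  rw [← Lp.inner_fourier_eq g v, ← Lp.inner_fourier_eq u h, L2.inner_def, L2.inner_def,
    ← integral_neg]
  apply integral_congr_ae
  filter_upwards [hu.fourier_ae_eq, hv.fourier_ae_eq] with x hx hy
  rw [hx, hy]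
  have h2 : (starRingEnd ℂ) 2 = 2 := Complex.conj_ofNat 2
  simp [h2]
  ring

theorem HasWeakPartial.add {i : Fin d} {u g v h : L2 d} (hu : HasWeakPartial i u g)
    (hv : HasWeakPartial i v h) : HasWeakPartial i (u + v) (g + h) := by
  unfold HasWeakPartial at *
  simp only [← Lp.toTemperedDistributionCLM_apply] at *
  rw [map_add, map_add, LineDeriv.lineDerivOp_add, hu, hv]

theorem HasWeakPartial.smul {i : Fin d} {u g : L2 d} (c : ℂ) (hu : HasWeakPartial i u g) :
    HasWeakPartial i (c • u) (c • g) := by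
  unfold HasWeakPartial at *
  simp only [← Lp.toTemperedDistributionCLM_apply] at *
  rw [map_smul, map_smul, LineDeriv.lineDerivOp_smul, hu]

theorem hasWeakPartial_zero (i : Fin d) : HasWeakPartial i (0 : L2 d) 0 := by
  unfold HasWeakPartial
  simp only [← Lp.toTemperedDistributionCLM_apply]
  rw [map_zero, LineDeriv.lineDerivOp_zero]

/-- The weak partial derivative is a closed operator in `L²`. -/
theorem HasWeakPartial.of_tendsto {i : Fin d} {u g : ℕ → L2 d} {u' g' : L2 d}
    (h : ∀ n, HasWeakPartial i (u n) (g n)) (hu : Tendsto u atTop (𝓝 u'))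
    (hg : Tendsto g atTop (𝓝 g')) : HasWeakPartial i u' g' := by
  unfold HasWeakPartial at *
  simp only [← Lp.toTemperedDistributionCLM_apply] at *
  have c1 : Continuous fun f : L2 d => ∂_{(EuclideanSpace.single i (1 : ℝ) : Pt d)}
      (Lp.toTemperedDistributionCLM ℂ (volume : Measure (Pt d)) 2 f) :=
    (LineDeriv.continuous_lineDerivOp _).comp (Lp.toTemperedDistributionCLM ℂ volume 2).continuous
  have h1 := (c1.tendsto u').comp hu
  have h2 := ((Lp.toTemperedDistributionCLM ℂ (volume : Measure (Pt d)) 2).continuous.tendsto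
    g').comp hg
  refine tendsto_nhds_unique h1 (h2.congr fun n => ?_)
  exact (h n).symm

/-- The product rule, for the product with a smooth function of compact support. -/
theorem HasWeakPartial.mul_smooth {i : Fin d} {u g u' g' : L2 d} (hu : HasWeakPartial i u g)
    {χ : Pt d → ℝ} (hχ : ContDiff ℝ ∞ χ) (hχc : HasCompactSupport χ)
    (hu' : u' =ᵐ[volume] fun x => (χ x : ℂ) * u x)
    (hg' : g' =ᵐ[volume] fun x => (χ x : ℂ) * g x
      + (fderiv ℝ χ x (EuclideanSpace.single i 1) : ℂ) * u x) :
    HasWeakPartial i u' g' := by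
  have hg₁ : HasCompactSupport (Complex.ofRealCLM ∘ χ) := hχc.comp_left rfl
  have hg₂ : ContDiff ℝ ∞ (Complex.ofRealCLM ∘ χ) := by fun_prop
  set c : 𝓢(Pt d, ℂ) := hg₁.toSchwartzMap hg₂ with hc
  have hcx : ∀ x, c x = (χ x : ℂ) := fun x => rfl
  set e : Pt d := EuclideanSpace.single i (1 : ℝ) with he
  have hct : (fun x => c x).HasTemperateGrowth := c.hasTemperateGrowth
  -- the definition of `g = ∂ᵢ u`, tested below against `χ ψ`
  have key : ∀ (ψ : 𝓢(Pt d, ℂ)), ∫ x, ψ x * g x = - ∫ x, (∂_{e} ψ) x * u x := by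
    intro ψ
    have := congrArg (fun T : 𝓢'(Pt d, ℂ) => T ψ) hu
    simp only [TemperedDistribution.lineDerivOp_apply_apply, Lp.toTemperedDistribution_apply,
      smul_eq_mul] at this
    rw [← this, ← integral_neg]
    congr 1; ext x; simp [he]
  have hint : ∀ (ψ : 𝓢(Pt d, ℂ)) (w : L2 d), Integrable (fun x => ψ x * w x) := by
    intro ψ w
    exact (ψ.memLp 2 volume).integrable_mul (Lp.memLp w)
  unfold HasWeakPartial
  ext ψ
  simp only [TemperedDistribution.lineDerivOp_apply_apply, Lp.toTemperedDistribution_apply,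
      smul_eq_mul]
  set η := SchwartzMap.smulLeftCLM ℂ (fun x => c x) ψ with hη
  have hηx : ∀ x, η x = (χ x : ℂ) * ψ x := fun x => by
    rw [hη, SchwartzMap.smulLeftCLM_apply_apply hct]; rfl
  have hdη : ∀ x, (∂_{e} η) x = (χ x : ℂ) * (∂_{e} ψ) x + (fderiv ℝ χ x e : ℂ) * ψ x := by
    intro x
    rw [SchwartzMap.lineDerivOp_apply_eq_fderiv, SchwartzMap.lineDerivOp_apply_eq_fderiv]
    have e1 : (η : Pt d → ℂ) = fun x => (Complex.ofRealCLM (χ x)) * ψ x := by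
      ext y; exact hηx y
    have d1 : HasFDerivAt (fun x => Complex.ofRealCLM (χ x))
        (Complex.ofRealCLM.comp (fderiv ℝ χ x)) x :=
      Complex.ofRealCLM.hasFDerivAt.comp x ((hχ.differentiable (by norm_num)) x).hasFDerivAt
    have d2 : HasFDerivAt (fun x => ψ x) (fderiv ℝ ψ x) x := ψ.differentiableAt.hasFDerivAt
    rw [e1, (d1.fun_mul d2).fderiv]
    simp; ring
  have hrem : Integrable (fun x => (fderiv ℝ χ x e : ℂ) * ψ x * u x) := by
    have : (fun x => (fderiv ℝ χ x e : ℂ) * ψ x * u x) = fun x =>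
        (∂_{e} η) x * u x - (SchwartzMap.smulLeftCLM ℂ (fun x => c x) (∂_{e} ψ)) x * u x := by
      ext x
      rw [hdη, SchwartzMap.smulLeftCLM_apply_apply hct, hcx]; simp; ring
    rw [this]
    exact (hint _ u).sub (hint _ u)
  have h1 := key η
  calc ∫ x, (-∂_{e} ψ) x * u' x = ∫ x, (-((∂_{e} ψ) x * (χ x : ℂ) * u x)) := by
        apply integral_congr_ae
        filter_upwards [hu'] with x hx
        rw [hx]; simp [mul_assoc]
    _ = ∫ x, (-((∂_{e} η) x * u x) + (fderiv ℝ χ x e : ℂ) * ψ x * u x) := by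
        congr 1; ext x; rw [hdη]; ring
    _ = (∫ x, (-((∂_{e} η) x * u x))) + ∫ x, (fderiv ℝ χ x e : ℂ) * ψ x * u x := by
        apply integral_add
        · exact (hint _ u).neg
        · exact hrem
    _ = (∫ x, η x * g x) + ∫ x, (fderiv ℝ χ x e : ℂ) * ψ x * u x := by
        rw [h1, integral_neg]
    _ = ∫ x, ψ x * g' x := by
        rw [← integral_add (hint _ _)]
        · apply integral_congr_ae
          filter_upwards [hg'] with x hx
          rw [hx, hηx]; ring
        · exact hrem

/-! ### The subcritical Sobolev embedding -/

theorem hasWeakPartial_weakPartial {u : L2 d} (hu : u ∈ H1 d) (i : Fin d) :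
    HasWeakPartial i u (weakPartial i u) := by
  obtain ⟨g, hg⟩ := hu i
  rw [weakPartial_eq hg]
  exact hg

theorem integrable_norm_sq (u : L2 d) : Integrable (fun x => ‖u x‖ ^ 2) :=
  (Lp.memLp u).integrable_norm_pow (by norm_num)

theorem norm_sq_eq_integral (u : L2 d) : ‖u‖ ^ 2 = ∫ x, ‖u x‖ ^ 2 := by
  have h := L2.inner_def (𝕜 := ℂ) u u
  simp_rw [inner_self_eq_norm_sq_to_K] at h
  have h2 : ∫ x, ((‖u x‖ : ℂ)) ^ 2 = ((∫ x, ‖u x‖ ^ 2 : ℝ) : ℂ) := by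
    rw [← integral_complex_ofReal]; congr 1; ext x; push_cast; rfl
  refine Complex.ofReal_injective ?_
  rw [← h2, Complex.ofReal_pow]
  exact h

/-- The low-frequency part of `u`: the inverse Fourier integral of `𝓕 u`, restricted to the ball of
radius `A`. It is a genuine function, defined at every point. -/
def lowPass (A : ℝ) (u : L2 d) : Pt d → ℂ :=
  𝓕⁻ ((Metric.ball (0 : Pt d) A).indicator (𝓕 u : L2 d))

theorem memLp_indicator_fourier (A : ℝ) (u : L2 d) :
    MemLp ((Metric.ball (0 : Pt d) A).indicator (𝓕 u : L2 d)) 2 volume :=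
  (Lp.memLp _).indicator measurableSet_ball

theorem integrable_indicator_fourier (A : ℝ) (u : L2 d) :
    Integrable ((Metric.ball (0 : Pt d) A).indicator (𝓕 u : L2 d)) volume := by
  rw [integrable_indicator_iff measurableSet_ball]
  have : IsFiniteMeasure (volume.restrict (Metric.ball (0 : Pt d) A)) :=
    ⟨by simpa using measure_ball_lt_top⟩
  exact ((Lp.memLp (𝓕 u : L2 d)).restrict _).integrable (by norm_num)

theorem norm_lowPass_le (A : ℝ) (u : L2 d) (x : Pt d) :
    ‖lowPass A u x‖ ≤ ∫ ξ, (Metric.ball (0 : Pt d) A).indicator (fun ξ => ‖(𝓕 u : L2 d) ξ‖) ξ := by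
  rw [lowPass, Real.fourierInv_eq]
  refine (norm_integral_le_integral_norm _).trans (le_of_eq ?_)
  congr 1; ext ξ
  rw [Circle.norm_smul, norm_indicator_eq_indicator_norm]

/-- On the Fourier side, `|∇u|²` is `(2π|ξ|)² |𝓕 u|²`. -/
theorem sum_norm_fourier_weakPartial_sq {u : L2 d} (hu : u ∈ H1 d) : ∀ᵐ ξ : Pt d,
    ∑ i, ‖(𝓕 (weakPartial i u) : L2 d) ξ‖ ^ 2
      = (2 * Real.pi) ^ 2 * ‖ξ‖ ^ 2 * ‖(𝓕 u : L2 d) ξ‖ ^ 2 := by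
  have hae : ∀ᵐ ξ : Pt d, ∀ i, (𝓕 (weakPartial i u) : L2 d) ξ
      = (2 * Real.pi * Complex.I) * (ξ i : ℂ) * (𝓕 u : L2 d) ξ :=
    ae_all_iff.mpr fun i => (hasWeakPartial_weakPartial hu i).fourier_ae_eq
  filter_upwards [hae] with ξ h1
  simp only [h1]
  rw [EuclideanSpace.real_norm_sq_eq, Finset.mul_sum, Finset.sum_mul]
  congr 1; ext i
  simp only [norm_mul, Complex.norm_I, Complex.norm_real, mul_pow, Real.norm_eq_abs, sq_abs]
  simp

/-- The high-frequency part of an `H¹` function is small in `L²`. -/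
theorem exists_lowPass_toL2 {A : ℝ} (hA : 0 < A) {u : L2 d} (hu : u ∈ H1 d) :
    ∃ w : L2 d, w =ᵐ[volume] lowPass A u ∧
      A ^ 2 * ‖u - w‖ ^ 2 ≤ ∑ i, ‖weakPartial i u‖ ^ 2 := by
  set h2 := memLp_indicator_fourier A u
  refine ⟨𝓕⁻ (h2.toLp _), fourierInv_toLp_ae_eq (integrable_indicator_fourier A u) h2, ?_⟩
  have e1 : ‖u - 𝓕⁻ (h2.toLp _)‖ = ‖(𝓕 u : L2 d) - h2.toLp _‖ := by
    rw [← Lp.norm_fourier_eq (u - _)]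
    congr 1
    have := (Lp.fourierTransformₗᵢ (Pt d) ℂ).map_sub u (𝓕⁻ (h2.toLp _))
    refine this.trans ?_
    congr 1
    exact FourierTransform.fourier_fourierInv_eq (E := L2 d) (F := L2 d) (h2.toLp _)
  have e2 : ∀ i, ‖weakPartial i u‖ ^ 2 = ∫ ξ, ‖(𝓕 (weakPartial i u) : L2 d) ξ‖ ^ 2 := by
    intro i
    rw [← norm_sq_eq_integral, Lp.norm_fourier_eq]
  rw [e1, norm_sq_eq_integral, ← integral_const_mul]
  simp_rw [e2]
  rw [← integral_finsetSum _ (fun i _ => integrable_norm_sq _)]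
  apply integral_mono_ae ((integrable_norm_sq _).const_mul _)
    (integrable_finsetSum _ fun i _ => integrable_norm_sq _)
  filter_upwards [sum_norm_fourier_weakPartial_sq hu, h2.coeFn_toLp,
    Lp.coeFn_sub (𝓕 u : L2 d) (h2.toLp _)] with ξ hs h3 h4
  rw [h4]
  simp only [Pi.sub_apply, h3]
  rw [hs]
  by_cases hξ : ξ ∈ Metric.ball (0 : Pt d) A
  · rw [Set.indicator_of_mem hξ]
    simp; positivity
  · rw [Set.indicator_of_notMem hξ, sub_zero]
    gcongr
    have : A ≤ ‖ξ‖ := by simpa using hξ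
    have hp : 1 ≤ (2 * Real.pi) ^ 2 := by
      have := Real.pi_gt_three
      nlinarith
    nlinarith [pow_le_pow_left₀ hA.le this 2, sq_nonneg ‖ξ‖]

/-- The Fourier transform of an `H¹` function is square integrable with the weight `1 + |ξ|²`. -/
theorem integrable_weight_fourier {u : L2 d} (hu : u ∈ H1 d) :
    Integrable (fun ξ : Pt d => (1 + ‖ξ‖ ^ 2) * ‖(𝓕 u : L2 d) ξ‖ ^ 2) := by
  have hI : Integrable (fun ξ : Pt d => ‖(𝓕 u : L2 d) ξ‖ ^ 2
      + ∑ i, ‖(𝓕 (weakPartial i u) : L2 d) ξ‖ ^ 2) :=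
    (integrable_norm_sq _).add (integrable_finsetSum _ fun i _ => integrable_norm_sq _)
  refine hI.mono' ?_ ?_
  · exact (by fun_prop : Continuous fun ξ : Pt d => 1 + ‖ξ‖ ^ 2).aestronglyMeasurable.mul
      (integrable_norm_sq _).aestronglyMeasurable
  filter_upwards [sum_norm_fourier_weakPartial_sq hu] with ξ hs
  rw [hs, Real.norm_of_nonneg (by positivity), add_mul, one_mul]
  gcongr
  have hp : 1 ≤ (2 * Real.pi) ^ 2 := by
    have := Real.pi_gt_three
    nlinarith
  nlinarith [sq_nonneg ‖ξ‖]

/-- The low-frequency part of an `H¹` function grows at most like `A ^ s`, for every positive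
`s > (d - 2) / 2`. With `a = 1 + |ξ|²`, the reason is the inequality
`|𝓕 u| ≤ A ^ s (2 ^ s a ^ (-1 - s) + a |𝓕 u|²)` in the ball of radius `A`: the first summand is
integrable since `d < 2 + 2 s`, the second since `u ∈ H¹`. -/
theorem exists_norm_lowPass_le {u : L2 d} (hu : u ∈ H1 d) {s : ℝ} (hs : 0 < s)
    (hds : (d : ℝ) < 2 + 2 * s) :
    ∃ K : ℝ, 0 < K ∧ ∀ A : ℝ, 1 ≤ A → ∀ x, ‖lowPass A u x‖ ≤ K * A ^ s := by
  set F : Pt d → ℝ := fun ξ => 2 ^ s * (1 + ‖ξ‖ ^ 2) ^ (-(2 + 2 * s) / 2)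
    + (1 + ‖ξ‖ ^ 2) * ‖(𝓕 u : L2 d) ξ‖ ^ 2 with hF
  have hFi : Integrable F :=
    ((integrable_rpow_neg_one_add_norm_sq (by simpa using hds)).const_mul _).add
      (integrable_weight_fourier hu)
  have hF0 : ∀ ξ, 0 ≤ F ξ := fun ξ => by positivity
  refine ⟨(∫ ξ, F ξ) + 1, by positivity, fun A hA x => (norm_lowPass_le A u x).trans ?_⟩
  have hA0 : 0 < A := by linarith
  have : ∫ ξ, (Metric.ball (0 : Pt d) A).indicator (fun ξ => ‖(𝓕 u : L2 d) ξ‖) ξ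
      ≤ ∫ ξ, A ^ s * F ξ := by
    apply integral_mono_of_nonneg
    · exact ae_of_all _ fun ξ => Set.indicator_nonneg (fun _ _ => norm_nonneg _) _
    · exact hFi.const_mul _
    · refine ae_of_all _ fun ξ => ?_
      by_cases hξ : ξ ∈ Metric.ball (0 : Pt d) A
      · simp only [Set.indicator_of_mem hξ]
        have hξ' : ‖ξ‖ < A := by simpa using hξ
        set a := 1 + ‖ξ‖ ^ 2 with ha
        have ha1 : 1 ≤ a := by rw [ha]; nlinarith [sq_nonneg ‖ξ‖]
        have ha2 : a ≤ 2 * A ^ 2 := by rw [ha]; nlinarith [norm_nonneg ξ]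
        set y := ‖(𝓕 u : L2 d) ξ‖ with hy
        have hy0 : 0 ≤ y := norm_nonneg _
        -- `a ^ s ≤ 2 ^ s * A ^ (2 s)` on the ball
        have h1 : a ^ s ≤ 2 ^ s * (A ^ s) ^ 2 := by
          calc a ^ s ≤ (2 * A ^ 2) ^ s := Real.rpow_le_rpow (by linarith) ha2 hs.le
            _ = 2 ^ s * (A ^ s) ^ 2 := by
              rw [Real.mul_rpow (by norm_num) (by positivity), ← Real.rpow_natCast, ←
                Real.rpow_mul hA0.le, ← Real.rpow_natCast, ← Real.rpow_mul hA0.le, mul_comm s]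
        have hB : 0 < A ^ s := by positivity
        set B := A ^ s
        have h2 : a ^ (-(2 + 2 * s) / 2) * a ^ s * a = 1 := by
          nth_rw 3 [← Real.rpow_one a]
          rw [← Real.rpow_add (by linarith), ← Real.rpow_add (by linarith)]
          convert Real.rpow_zero a using 2
          ring
        set P := a ^ (-(2 + 2 * s) / 2) with hP
        have hP0 : 0 < P := by positivity
        have h3 : 1 ≤ 2 ^ s * P * B ^ 2 * a := by
          calc (1 : ℝ) = P * a ^ s * a := h2.symm
            _ ≤ P * (2 ^ s * B ^ 2) * a := by gcongr
            _ = _ := by ring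
        show y ≤ B * (2 ^ s * P + a * y ^ 2)
        have h4 : 1 ≤ (B * (2 ^ s * P)) * (B * a) := by nlinarith
        have h5 : 0 < B * a := by positivity
        have h6 : 1 / (B * a) ≤ B * (2 ^ s * P) := by
          rw [div_le_iff₀ h5]; exact h4
        -- the arithmetic-geometric mean inequality
        have h7 : y ≤ 1 / (B * a) + (B * a) * y ^ 2 := by
          have : 1 / (B * a) + (B * a) * y ^ 2 - y
              = ((B * a * y - 1 / 2) ^ 2 + 3 / 4) / (B * a) := by
            field_simp; ring
          have h8 : 0 ≤ ((B * a * y - 1 / 2) ^ 2 + 3 / 4) / (B * a) := by positivity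
          linarith
        linarith
      · simp only [Set.indicator_of_notMem hξ]
        have := hF0 ξ
        positivity
  rw [integral_const_mul] at this
  have h9 : 0 < A ^ s := by positivity
  linarith

/-- The Chebyshev inequality in `L²`. -/
theorem volume_lt_norm_le (w : L2 d) {t : ℝ} (ht : 0 < t) :
    volume {x | t < ‖w x‖} ≤ ENNReal.ofReal (‖w‖ ^ 2 / t ^ 2) := by
  have h := mul_meas_ge_le_lintegral₀ (μ := volume)
    (f := fun x => ENNReal.ofReal (‖w x‖ ^ 2)) (integrable_norm_sq w).aemeasurable.ennreal_ofReal
    (ENNReal.ofReal (t ^ 2))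
  rw [← ofReal_integral_eq_lintegral_ofReal (integrable_norm_sq w)
    (ae_of_all _ fun x => by positivity), ← norm_sq_eq_integral] at h
  have hpos : ENNReal.ofReal (t ^ 2) ≠ 0 := by
    simpa using ht.ne'
  rw [ENNReal.ofReal_div_of_pos (by positivity)]
  rw [ENNReal.le_div_iff_mul_le (Or.inl hpos) (Or.inl ENNReal.ofReal_ne_top), mul_comm]
  refine le_trans ?_ h
  gcongr
  intro hx
  apply ENNReal.ofReal_le_ofReal
  gcongr

/-- An `L²` function whose level sets decay like `t ^ (-r)` is in `L^q` for `2 < q < r`. -/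
theorem integrable_rpow_of_tail (u : L2 d) {q r t₀ C : ℝ} (hq : 2 < q) (hqr : q < r)
    (ht₀ : 0 < t₀)
    (h : ∀ t, t₀ < t → volume {x | t < ‖u x‖} ≤ ENNReal.ofReal (C * t ^ (-r))) :
    Integrable (fun x => ‖u x‖ ^ q) := by
  have hm : AEMeasurable (fun x => ‖u x‖) volume := (Lp.aestronglyMeasurable u).norm.aemeasurable
  refine ⟨(hm.pow_const q).aestronglyMeasurable, ?_⟩
  rw [hasFiniteIntegral_iff_ofReal (ae_of_all _ fun x => by positivity),
    lintegral_rpow_eq_lintegral_meas_lt_mul volume (ae_of_all _ fun x => norm_nonneg _) hm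
      (by linarith)]
  refine ENNReal.mul_lt_top ENNReal.ofReal_lt_top ?_
  rw [← Set.Ioc_union_Ioi_eq_Ioi ht₀.le]
  refine (lintegral_union_le _ _ _).trans_lt (ENNReal.add_lt_top.mpr ⟨?_, ?_⟩)
  -- for small `t` the Chebyshev bound `t ^ (-2)` suffices, as `q > 2`
  · have hi : IntegrableOn (fun t : ℝ => ‖u‖ ^ 2 * t ^ (q - 3)) (Set.Ioc 0 t₀) := by
      refine Integrable.const_mul ?_ _
      exact (intervalIntegrable_iff_integrableOn_Ioc_of_le ht₀.le).mp
        (intervalIntegral.intervalIntegrable_rpow' (by linarith))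
    refine lt_of_le_of_lt ?_ hi.lintegral_lt_top
    refine setLIntegral_mono_ae' measurableSet_Ioc (ae_of_all _ fun t ht => ?_)
    calc _ ≤ ENNReal.ofReal (‖u‖ ^ 2 / t ^ 2) * ENNReal.ofReal (t ^ (q - 1)) := by
          gcongr; exact volume_lt_norm_le u ht.1
      _ = _ := by
          rw [← ENNReal.ofReal_mul (by positivity)]
          congr 1
          have : t ^ (q - 1) = t ^ (q - 3) * t ^ 2 := by
            rw [← Real.rpow_natCast, ← Real.rpow_add ht.1]; congr 1; push_cast; ring
          rw [this]
          have := ht.1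
          field_simp
  · have hi : IntegrableOn (fun t : ℝ => C * t ^ (q - 1 - r)) (Set.Ioi t₀) :=
      (integrableOn_Ioi_rpow_of_lt (by linarith) ht₀).const_mul _
    refine lt_of_le_of_lt ?_ hi.lintegral_lt_top
    refine setLIntegral_mono_ae' measurableSet_Ioi (ae_of_all _ fun t ht => ?_)
    have ht' : 0 < t := ht₀.trans ht
    calc _ ≤ ENNReal.ofReal (C * t ^ (-r)) * ENNReal.ofReal (t ^ (q - 1)) := by
          gcongr; exact h t ht
      _ = _ := by
          rw [← ENNReal.ofReal_mul' (by positivity), mul_assoc, ← Real.rpow_add ht']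
          congr 3; ring

/-- The subcritical Sobolev embedding of `H¹`. As `s` approaches `(d - 2) / 2`, the bound
`2 + 2 / s` on the exponent approaches the critical exponent `2 d / (d - 2)`. -/
theorem integrable_rpow_of_mem_H1 {u : L2 d} (hu : u ∈ H1 d) {s q : ℝ} (hs : 0 < s)
    (hds : (d : ℝ) < 2 + 2 * s) (hq : 2 < q) (hqs : q < 2 + 2 / s) :
    Integrable (fun x => ‖u x‖ ^ q) := by
  obtain ⟨K, hK, hKA⟩ := exists_norm_lowPass_le hu hs hds
  set D := ∑ i, ‖weakPartial i u‖ ^ 2 with hD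
  refine integrable_rpow_of_tail u (r := 2 + 2 / s) (t₀ := 2 * K)
    (C := 4 * D * (2 * K) ^ (2 / s)) hq hqs (by positivity) fun t ht => ?_
  -- the frequency `A` for which the low-frequency part is at most `t / 2`
  set A := (t / (2 * K)) ^ (1 / s) with hAdef
  have ht0 : 0 < t := by linarith [mul_pos two_pos hK]
  have hA1 : 1 ≤ A := Real.one_le_rpow ((one_le_div (by positivity)).mpr ht.le) (by positivity)
  have hAs : K * A ^ s = t / 2 := by
    rw [hAdef, ← Real.rpow_mul (by positivity), one_div_mul_cancel hs.ne', Real.rpow_one]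
    field_simp
  obtain ⟨w, hw, hwA⟩ := exists_lowPass_toL2 (by linarith : 0 < A) hu
  have hsub : volume {x | t < ‖u x‖} ≤ volume {x | t / 2 < ‖(u - w : L2 d) x‖} := by
    apply measure_mono_ae
    filter_upwards [hw, Lp.coeFn_sub u w] with x h1 h2 h3
    have h3 : t < ‖u x‖ := h3
    show t / 2 < ‖(u - w : L2 d) x‖
    rw [h2, Pi.sub_apply, h1]
    have := hKA A hA1 x
    have := norm_sub_norm_le (u x) (lowPass A u x)
    linarith
  refine hsub.trans ((volume_lt_norm_le _ (by positivity)).trans (ENNReal.ofReal_le_ofReal ?_))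
  have hA2 : A ^ 2 = (t / (2 * K)) ^ (2 / s) := by
    rw [hAdef, ← Real.rpow_natCast, ← Real.rpow_mul (by positivity)]
    congr 1; push_cast; ring
  have h5 : ‖u - w‖ ^ 2 ≤ D / A ^ 2 := by
    rw [le_div_iff₀ (by positivity), mul_comm]; exact hwA
  calc ‖u - w‖ ^ 2 / (t / 2) ^ 2 ≤ (D / A ^ 2) / (t / 2) ^ 2 := by gcongr
    _ = 4 * D * (2 * K) ^ (2 / s) * t ^ (-(2 + 2 / s)) := by
      rw [hA2, Real.div_rpow ht0.le (by positivity), Real.rpow_neg ht0.le, Real.rpow_add ht0,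
        Real.rpow_two]
      have : 0 < t ^ (2 / s) := by positivity
      have : 0 < (2 * K) ^ (2 / s) := by positivity
      field_simp
      norm_num
    _ ≤ _ := le_refl _

/-! ### Compactness of the energy space in `L²` -/

/-- Evaluation of the low-frequency part at a point is a bounded linear functional of `𝓕 u`, with a
bound that does not depend on the point. -/
theorem exists_lowPass_eq_inner (d : ℕ) (A : ℝ) : ∃ C : ℝ, ∀ x : Pt d, ∃ e : L2 d, ‖e‖ ≤ C ∧
    ∀ u : L2 d, lowPass A u x = inner ℂ e (𝓕 u) := by
  set B := Metric.ball (0 : Pt d) A with hB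
  have hBm : MeasurableSet B := measurableSet_ball
  have hBf : volume B ≠ ⊤ := measure_ball_lt_top.ne
  refine ⟨‖(indicatorConstLp 2 hBm hBf (1 : ℂ) : L2 d)‖, fun x => ?_⟩
  set k : Pt d → ℂ := B.indicator fun ξ => conj ((Real.fourierChar (inner ℝ ξ x) : Circle) : ℂ)
    with hk
  have hkm : AEStronglyMeasurable k volume := by
    refine AEStronglyMeasurable.indicator ?_ hBm
    refine Continuous.aestronglyMeasurable ?_
    have h1 : Continuous fun ξ : Pt d => Real.fourierChar (inner ℝ ξ x) :=
      Real.continuous_fourierChar.comp (by fun_prop)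
    have h2 : Continuous fun ξ : Pt d => ((Real.fourierChar (inner ℝ ξ x) : Circle) : ℂ) :=
      continuous_induced_dom.comp h1
    exact Complex.continuous_conj.comp h2
  have hkn : ∀ ξ, ‖k ξ‖ = ‖B.indicator (fun _ => (1 : ℂ)) ξ‖ := by
    intro ξ
    by_cases hξ : ξ ∈ B
    · simp only [hk, Set.indicator_of_mem hξ, RCLike.norm_conj, Circle.norm_coe, norm_one]
    · simp only [hk, Set.indicator_of_notMem hξ]
  have hk2 : MemLp k 2 volume := by
    refine (memLp_indicator_const 2 hBm (1 : ℂ) (Or.inr hBf)).mono hkm (ae_of_all _ fun ξ => ?_)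
    rw [hkn]
  refine ⟨hk2.toLp k, ?_, fun u => ?_⟩
  · refine Lp.norm_le_norm_of_ae_le ?_
    filter_upwards [hk2.coeFn_toLp, indicatorConstLp_coeFn (p := 2) (hs := hBm) (hμs := hBf)
      (c := (1 : ℂ))] with ξ h1 h2
    rw [h1, h2, hkn]
  · rw [L2.inner_def, lowPass, Real.fourierInv_eq]
    apply integral_congr_ae
    filter_upwards [hk2.coeFn_toLp] with ξ h1
    rw [h1, hk]
    by_cases hξ : ξ ∈ B
    · simp only [Set.indicator_of_mem hξ, Circle.smul_def, RCLike.inner_apply, ← hB,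
        RingHomCompTriple.comp_apply, RingHom.id_apply, smul_eq_mul, mul_comm]
    · simp only [Set.indicator_of_notMem hξ, ← hB]
      simp

/-- Bounded sequences in a separable Hilbert space have weakly convergent subsequences. -/
theorem exists_weak_subseq (w : ℕ → L2 d) {M : ℝ} (hw : ∀ n, ‖w n‖ ≤ M) :
    ∃ (W : L2 d) (φ : ℕ → ℕ), StrictMono φ ∧
      ∀ e : L2 d, Tendsto (fun n => inner ℂ e (w (φ n))) atTop (𝓝 (inner ℂ e W)) := by
  have : Fact ((2 : ℝ≥0∞) ≠ ⊤) := ⟨by norm_num⟩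
  have hsep : TopologicalSpace.SeparableSpace (L2 d) := inferInstance
  have hc := WeakDual.isSeqCompact_closedBall ℂ (L2 d) 0 M
  obtain ⟨a, ha, φ, hφ, hlim⟩ := hc (x := fun n => StrongDual.toWeakDual
    (InnerProductSpace.toDual ℂ (L2 d) (w n))) (fun n => by simpa using hw n)
  refine ⟨(InnerProductSpace.toDual ℂ (L2 d)).symm (WeakDual.toStrongDual a), φ, hφ, fun e => ?_⟩
  have h1 : Tendsto (fun n => inner ℂ (w (φ n)) e) atTop (𝓝 (a e)) :=
    ((WeakDual.eval_continuous e).tendsto a).comp hlim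
  have h2 := (Complex.continuous_conj.tendsto _).comp h1
  have h3 : a e = inner ℂ
      ((InnerProductSpace.toDual ℂ (L2 d)).symm (WeakDual.toStrongDual a)) e := by
    rw [InnerProductSpace.toDual_symm_apply]; rfl
  rw [h3, inner_conj_symm] at h2
  refine h2.congr fun n => ?_
  simp

theorem setIntegral_norm_sq_le (u : L2 d) (s : Set (Pt d)) :
    ∫ x in s, ‖u x‖ ^ 2 ≤ ‖u‖ ^ 2 := by
  rw [norm_sq_eq_integral]
  exact setIntegral_le_integral (integrable_norm_sq u) (ae_of_all _ fun x => by positivity)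

theorem norm_add_sq_le_two (a b : ℂ) : ‖a + b‖ ^ 2 ≤ 2 * ‖a‖ ^ 2 + 2 * ‖b‖ ^ 2 := by
  have := norm_add_le a b
  nlinarith [sq_nonneg (‖a‖ - ‖b‖), norm_nonneg a, norm_nonneg b, norm_nonneg (a + b)]

/-- Splitting the `L²` norm into a bounded region and its complement, and, in the bounded region,
into low and high frequencies. -/
theorem norm_sq_le_split {A : ℝ} (hA : 0 < A) {u : L2 d} (hu : u ∈ H1 d) (R : ℝ) :
    ‖u‖ ^ 2 ≤ (∫ x in (Metric.closedBall (0 : Pt d) R)ᶜ, ‖u x‖ ^ 2)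
      + 2 * (∫ x in Metric.closedBall (0 : Pt d) R, ‖lowPass A u x‖ ^ 2)
      + 2 * ((∑ i, ‖weakPartial i u‖ ^ 2) / A ^ 2) := by
  obtain ⟨w, hw, hwA⟩ := exists_lowPass_toL2 hA hu
  set B := Metric.closedBall (0 : Pt d) R
  have hBm : MeasurableSet B := measurableSet_closedBall
  have e1 : ‖u‖ ^ 2 = (∫ x in B, ‖u x‖ ^ 2) + ∫ x in Bᶜ, ‖u x‖ ^ 2 := by
    rw [norm_sq_eq_integral, integral_add_compl hBm (integrable_norm_sq u)]
  have e2 : ∫ x in B, ‖u x‖ ^ 2 ≤ ∫ x in B, (2 * ‖w x‖ ^ 2 + 2 * ‖(u - w : L2 d) x‖ ^ 2) := by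
    apply integral_mono_ae (integrable_norm_sq u).integrableOn
    · exact (((integrable_norm_sq w).const_mul 2).add
        ((integrable_norm_sq (u - w)).const_mul 2)).integrableOn
    · apply ae_restrict_of_ae
      filter_upwards [Lp.coeFn_sub u w] with x hx
      have := norm_add_sq_le_two (w x) ((u - w : L2 d) x)
      rw [hx] at this ⊢
      simpa using this
  rw [integral_add ((integrable_norm_sq w).const_mul 2).integrableOn
        ((integrable_norm_sq (u - w)).const_mul 2).integrableOn, integral_const_mul,
        integral_const_mul] at e2
  have e3 : ∫ x in B, ‖w x‖ ^ 2 = ∫ x in B, ‖lowPass A u x‖ ^ 2 := by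
    apply integral_congr_ae
    apply ae_restrict_of_ae
    filter_upwards [hw] with x hx
    rw [hx]
  have e4 := setIntegral_norm_sq_le (u - w) B
  have e5 : ‖u - w‖ ^ 2 ≤ (∑ i, ‖weakPartial i u‖ ^ 2) / A ^ 2 := by
    rw [le_div_iff₀ (by positivity), mul_comm]; exact hwA
  rw [e3] at e2
  linarith

/-- Along a sequence whose Fourier transforms converge weakly, the low-frequency parts form a
Cauchy sequence in `L²` of every ball. -/
theorem lowPass_cauchy {u : ℕ → L2 d} {W : L2 d} {M : ℝ} (hM : ∀ n, ‖u n‖ ≤ M)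
    (h : ∀ e : L2 d, Tendsto (fun n => inner ℂ e (𝓕 (u n))) atTop (𝓝 (inner ℂ e W)))
    (A R : ℝ) {ε : ℝ} (hε : 0 < ε) : ∃ N, ∀ n ≥ N, ∀ m ≥ N,
      ∫ x in Metric.closedBall (0 : Pt d) R, ‖lowPass A (u n - u m) x‖ ^ 2 ≤ ε := by
  obtain ⟨C, hC⟩ := exists_lowPass_eq_inner d A
  choose e he hlow using hC
  have hsub : ∀ (v w : L2 d) x, lowPass A (v - w) x = lowPass A v x - lowPass A w x := by
    intro v w x
    rw [hlow, hlow, hlow, ← inner_sub_right]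
    congr 1
    exact (Lp.fourierTransformₗᵢ (Pt d) ℂ).map_sub v w
  set B := Metric.closedBall (0 : Pt d) R
  have hBfin : IsFiniteMeasure (volume.restrict B) := ⟨by
    rw [Measure.restrict_apply_univ]; exact measure_closedBall_lt_top⟩
  set l : Pt d → ℂ := fun x => inner ℂ (e x) W with hl
  have hmeas : ∀ n, AEStronglyMeasurable (lowPass A (u n)) volume := by
    intro n
    exact (Lp.aestronglyMeasurable _).congr
      (fourierInv_toLp_ae_eq (integrable_indicator_fourier A (u n))
        (memLp_indicator_fourier A (u n)))
  have hlim : ∀ x, Tendsto (fun n => lowPass A (u n) x) atTop (𝓝 (l x)) := by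
    intro x
    simp_rw [hlow]
    exact h (e x)
  have hlmeas : AEStronglyMeasurable l volume :=
    aestronglyMeasurable_of_tendsto_ae atTop hmeas (ae_of_all _ hlim)
  have hC0 : 0 ≤ C := (norm_nonneg _).trans (he 0)
  have hbd : ∀ n x, ‖lowPass A (u n) x‖ ≤ C * M := by
    intro n x
    rw [hlow]
    refine (norm_inner_le_norm _ _).trans ?_
    rw [Lp.norm_fourier_eq]
    exact mul_le_mul (he x) (hM n) (norm_nonneg _) hC0
  have hlbd : ∀ x, ‖l x‖ ≤ C * M := fun x =>
    le_of_tendsto (hlim x).norm (Eventually.of_forall fun n => hbd n x)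
  have hdist : ∀ n x, ‖lowPass A (u n) x - l x‖ ^ 2 ≤ (2 * (C * M)) ^ 2 := by
    intro n x
    apply pow_le_pow_left₀ (norm_nonneg _)
    refine (norm_sub_le _ _).trans ?_
    linarith [hbd n x, hlbd x]
  have hmeasd : ∀ n, AEStronglyMeasurable (fun x => ‖lowPass A (u n) x - l x‖ ^ 2) volume :=
    fun n => ((hmeas n).sub hlmeas).norm.pow 2
  have hconv : Tendsto (fun n => ∫ x in B, ‖lowPass A (u n) x - l x‖ ^ 2) atTop (𝓝 0) := by
    have := tendsto_integral_of_dominated_convergence (μ := volume.restrict B)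
      (F := fun n x => ‖lowPass A (u n) x - l x‖ ^ 2) (f := fun _ => (0 : ℝ))
      (fun _ => (2 * (C * M)) ^ 2) (fun n => (hmeasd n).restrict) (integrable_const _)
      (fun n => ae_of_all _ fun x => by
        rw [Real.norm_of_nonneg (by positivity)]; exact hdist n x)
      (ae_of_all _ fun x => by
        have := ((hlim x).sub_const (l x)).norm.pow 2
        simpa using this)
    simpa using this
  have hint : ∀ n, Integrable (fun x => ‖lowPass A (u n) x - l x‖ ^ 2) (volume.restrict B) := by
    intro n
    refine Integrable.mono' (integrable_const ((2 * (C * M)) ^ 2)) (hmeasd n).restrict ?_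
    refine ae_of_all _ fun x => ?_
    rw [Real.norm_of_nonneg (by positivity)]; exact hdist n x
  obtain ⟨N, hN⟩ := eventually_atTop.mp (hconv.eventually (gt_mem_nhds (by linarith : 0 < ε / 4)))
  refine ⟨N, fun n hn m hm => ?_⟩
  have h1 : ∫ x in B, ‖lowPass A (u n - u m) x‖ ^ 2 ≤ ∫ x in B,
      (2 * ‖lowPass A (u n) x - l x‖ ^ 2 + 2 * ‖lowPass A (u m) x - l x‖ ^ 2) := by
    apply integral_mono_of_nonneg (ae_of_all _ fun x => by positivity)
      (((hint n).const_mul 2).add ((hint m).const_mul 2))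
    refine ae_of_all _ fun x => ?_
    have := norm_add_sq_le_two (lowPass A (u n) x - l x) (-(lowPass A (u m) x - l x))
    rw [norm_neg] at this
    simp only [hsub]
    rwa [← sub_eq_add_neg, sub_sub_sub_cancel_right] at this
  rw [integral_add ((hint n).const_mul 2) ((hint m).const_mul 2), integral_const_mul,
    integral_const_mul] at h1
  have := hN n hn
  have := hN m hm
  linarith

/-- The embedding of the energy space into `L²` is compact: sequences that are bounded in `H¹` and
in `L²(V)` have subsequences that converge in `L²`. The bounds are on the differences, which are
what the proof that a subsequence is a Cauchy sequence needs. -/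
theorem exists_tendsto_subseq {V : Pt d → ℝ} (hV : Tendsto V (cocompact (Pt d)) atTop)
    (hV0 : ∀ x, 0 ≤ V x) {M : ℝ} {u : ℕ → L2 d}
    (hX : ∀ n m, u n - u m ∈ X V) (hM : ∀ n, ‖u n‖ ≤ M)
    (hD : ∀ n m, ∑ i, ‖weakPartial i (u n - u m)‖ ^ 2 ≤ M)
    (hVM : ∀ n m, ∫ x, V x * ‖(u n - u m : L2 d) x‖ ^ 2 ≤ M) :
    ∃ (U : L2 d) (φ : ℕ → ℕ), StrictMono φ ∧ Tendsto (fun n => u (φ n)) atTop (𝓝 U) := by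
  have hM0 : 0 ≤ M := (norm_nonneg _).trans (hM 0)
  obtain ⟨W, φ, hφ, hW⟩ := exists_weak_subseq (fun n => 𝓕 (u n) : ℕ → L2 d) (M := M)
    (fun n => by simpa using hM n)
  suffices CauchySeq fun n => u (φ n) by
    obtain ⟨U, hU⟩ := cauchySeq_tendsto_of_complete this
    exact ⟨U, φ, hφ, hU⟩
  rw [Metric.cauchySeq_iff]
  intro ε hε
  -- `κ` splits the error `ε²` among the tail, the high and the low frequencies
  set κ := ε ^ 2 / 8 with hκ
  have hκ0 : 0 < κ := by positivity
  obtain ⟨R, hR⟩ : ∃ R : ℝ, ∀ x ∉ Metric.closedBall (0 : Pt d) R, M / κ + 1 ≤ V x := by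
    have h1 := hV.eventually (eventually_ge_atTop (M / κ + 1))
    obtain ⟨K, hK, hKc⟩ := mem_cocompact.mp h1
    obtain ⟨R, hR⟩ := hK.isBounded.subset_closedBall (0 : Pt d)
    exact ⟨R, fun x hx => hKc fun hxK => hx (hR hxK)⟩
  set A := Real.sqrt (M / κ + 1) with hA
  have hA0 : 0 < A := Real.sqrt_pos.mpr (by positivity)
  have hA2 : A ^ 2 = M / κ + 1 := Real.sq_sqrt (by positivity)
  obtain ⟨N, hN⟩ := lowPass_cauchy (u := fun n => u (φ n)) (fun n => hM _) hW A R hκ0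
  have hMκ : M / (M / κ + 1) ≤ κ := by
    rw [div_le_iff₀ (by positivity)]
    have : κ * (M / κ + 1) = M + κ := by field_simp
    linarith
  refine ⟨N, fun n hn m hm => ?_⟩
  have hz := hX (φ n) (φ m)
  have h1 := norm_sq_le_split hA0 hz.1 R
  have h2 := hN n hn m hm
  have h3 : (∑ i, ‖weakPartial i (u (φ n) - u (φ m))‖ ^ 2) / A ^ 2 ≤ κ := by
    rw [hA2]
    exact (div_le_div_of_nonneg_right (hD _ _) (by positivity)).trans hMκ
  have h4 : ∫ x in (Metric.closedBall (0 : Pt d) R)ᶜ, ‖(u (φ n) - u (φ m) : L2 d) x‖ ^ 2 ≤ κ := by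
    have h5 : ∫ x in (Metric.closedBall (0 : Pt d) R)ᶜ,
        (M / κ + 1) * ‖(u (φ n) - u (φ m) : L2 d) x‖ ^ 2 ≤ M := by
      refine le_trans ?_ (hVM (φ n) (φ m))
      refine le_trans (setIntegral_mono_on ((integrable_norm_sq _).const_mul _).integrableOn
        hz.2.integrableOn measurableSet_closedBall.compl fun x hx => ?_)
        (setIntegral_le_integral hz.2 (ae_of_all _ fun x => ?_))
      · have := hR x hx
        gcongr
      · have := hV0 x
        positivity
    rw [integral_const_mul] at h5
    refine le_trans ?_ hMκ
    rw [le_div_iff₀ (by positivity)]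
    linarith
  rw [dist_eq_norm]
  refine lt_of_pow_lt_pow_left₀ 2 hε.le ?_
  have : ε ^ 2 = 8 * κ := by rw [hκ]; ring
  linarith

/-! ### Symmetry of the angular momentum -/

theorem memLp_mul_of_hasCompactSupport {c : Pt d → ℝ} (hc : Continuous c)
    (hcc : HasCompactSupport c) (u : L2 d) : MemLp (fun x => (c x : ℂ) * u x) 2 volume := by
  obtain ⟨C, hC⟩ := hcc.exists_bound_of_continuous hc
  refine MemLp.of_le_mul (c := C) (Lp.memLp u) ?_ (ae_of_all _ fun x => ?_)
  · exact (Complex.continuous_ofReal.comp hc).aestronglyMeasurable.mul (Lp.aestronglyMeasurable u)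
  · rw [norm_mul, Complex.norm_real]
    exact mul_le_mul_of_nonneg_right (hC x) (norm_nonneg _)

/-- Integration by parts against a smooth compactly supported multiple of an `H¹` function. -/
theorem integral_weakPartial_mul {i : Fin d} {u g v h : L2 d} (hu : HasWeakPartial i u g)
    (hv : HasWeakPartial i v h) {χ : Pt d → ℝ} (hχ : ContDiff ℝ ∞ χ) (hχc : HasCompactSupport χ) :
    ∫ x, conj (g x) * ((χ x : ℂ) * v x) = - (∫ x, conj (u x) * ((χ x : ℂ) * h x))
      - ∫ x, conj (u x) * ((fderiv ℝ χ x (EuclideanSpace.single i 1) : ℂ) * v x) := by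
  have m1 := memLp_mul_of_hasCompactSupport hχ.continuous hχc v
  have m2 := memLp_mul_of_hasCompactSupport hχ.continuous hχc h
  have hd : Continuous fun x => fderiv ℝ χ x (EuclideanSpace.single i 1) :=
    (hχ.continuous_fderiv (by norm_num)).clm_apply continuous_const
  have hdc : HasCompactSupport fun x => fderiv ℝ χ x (EuclideanSpace.single i 1) :=
    hχc.fderiv_apply ℝ _
  have m3 := memLp_mul_of_hasCompactSupport hd hdc v
  have hw : HasWeakPartial i (m1.toLp _) ((m2.add m3).toLp _) :=
    hv.mul_smooth hχ hχc m1.coeFn_toLp (m2.add m3).coeFn_toLp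
  have key := inner_weakPartial_left hu hw
  rw [L2.inner_def, L2.inner_def] at key
  have hcu : MemLp (fun x => conj (u x)) 2 volume := (Lp.memLp u).star
  have e1 : ∫ x, inner ℂ (g x) (m1.toLp _ x) = ∫ x, conj (g x) * ((χ x : ℂ) * v x) := by
    apply integral_congr_ae
    filter_upwards [m1.coeFn_toLp] with x hx
    rw [hx, RCLike.inner_apply, mul_comm]
  have e2 : ∫ x, inner ℂ (u x) ((m2.add m3).toLp _ x)
      = (∫ x, conj (u x) * ((χ x : ℂ) * h x))
        + ∫ x, conj (u x) * ((fderiv ℝ χ x (EuclideanSpace.single i 1) : ℂ) * v x) := by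
    have i2 : Integrable fun x => conj (u x) * ((χ x : ℂ) * h x) := hcu.integrable_mul m2
    have i3 : Integrable fun x => conj (u x) *
        ((fderiv ℝ χ x (EuclideanSpace.single i 1) : ℂ) * v x) := hcu.integrable_mul m3
    rw [← integral_add i2 i3]
    apply integral_congr_ae
    filter_upwards [(m2.add m3).coeFn_toLp] with x hx
    rw [hx, RCLike.inner_apply, Pi.add_apply]
    ring
  rw [e1, e2] at key
  rw [key]; ring

/-- A radial smooth cutoff: it is `1` on the ball of radius `√(n+1)` and has compact support. -/
def cutoff (n : ℕ) (x : Pt d) : ℝ := Real.smoothTransition (2 - ‖x‖ ^ 2 / (n + 1))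

theorem contDiff_cutoff (n : ℕ) : ContDiff ℝ ∞ (cutoff n : Pt d → ℝ) := by
  unfold cutoff
  refine Real.smoothTransition.contDiff.comp ?_
  exact contDiff_const.sub ((contDiff_norm_sq ℝ).div_const _)

theorem cutoff_nonneg (n : ℕ) (x : Pt d) : 0 ≤ cutoff n x := Real.smoothTransition.nonneg _

theorem cutoff_le_one (n : ℕ) (x : Pt d) : cutoff n x ≤ 1 := Real.smoothTransition.le_one _

theorem hasCompactSupport_cutoff (n : ℕ) : HasCompactSupport (cutoff n : Pt d → ℝ) := by
  refine HasCompactSupport.intro (isCompact_closedBall 0 (2 * ((n : ℝ) + 1))) fun x hx => ?_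
  have h1 : 2 * ((n : ℝ) + 1) < ‖x‖ := by simpa using hx
  refine Real.smoothTransition.zero_of_nonpos ?_
  have hn : (0 : ℝ) < n + 1 := by positivity
  rw [sub_nonpos, le_div_iff₀ hn]
  nlinarith

theorem tendsto_cutoff (x : Pt d) : Tendsto (fun n => cutoff n x) atTop (𝓝 1) := by
  refine tendsto_const_nhds.congr' ?_
  filter_upwards [eventually_ge_atTop ⌈‖x‖ ^ 2⌉₊] with n hn
  refine (Real.smoothTransition.one_of_one_le ?_).symm
  have h1 : ‖x‖ ^ 2 ≤ n := (Nat.le_ceil _).trans (by exact_mod_cast hn)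
  have h2 : ‖x‖ ^ 2 / (n + 1) ≤ 1 := by
    rw [div_le_one (by positivity)]; linarith
  linarith

/-- The rotation field annihilates the radial cutoff, hence
`∂ⱼ (xₖ χ) = ∂ₖ (xⱼ χ)` for `j ≠ k`. -/
theorem fderiv_coord_mul_cutoff {j k : Fin d} (hjk : j ≠ k) (n : ℕ) (x : Pt d) :
    fderiv ℝ (fun y : Pt d => y k * cutoff n y) x (EuclideanSpace.single j 1)
      = fderiv ℝ (fun y : Pt d => y j * cutoff n y) x (EuclideanSpace.single k 1) := by
  have hc : ∀ l : Fin d, HasFDerivAt (fun y : Pt d => y l)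
      (EuclideanSpace.proj l : Pt d →L[ℝ] ℝ) x := fun l =>
    (EuclideanSpace.proj l : Pt d →L[ℝ] ℝ).hasFDerivAt
  set D := deriv Real.smoothTransition (2 - ‖x‖ ^ 2 / (n + 1))
  have hcut : HasFDerivAt (cutoff n : Pt d → ℝ)
      (D • (-(((n : ℝ) + 1)⁻¹ • (2 • innerSL ℝ x)) : Pt d →L[ℝ] ℝ)) x := by
    have h1 : HasFDerivAt (fun y : Pt d => 2 - ‖y‖ ^ 2 / ((n : ℝ) + 1))
        (-(((n : ℝ) + 1)⁻¹ • (2 • innerSL ℝ x)) : Pt d →L[ℝ] ℝ) x := by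
      have := ((hasStrictFDerivAt_norm_sq x).hasFDerivAt.mul_const (((n : ℝ) + 1)⁻¹)).const_sub 2
      simpa [div_eq_mul_inv] using this
    have h2 : HasDerivAt Real.smoothTransition D (2 - ‖x‖ ^ 2 / (n + 1)) :=
      ((Real.smoothTransition.contDiff (n := 1)).differentiable (by norm_num) _).hasDerivAt
    exact h2.comp_hasFDerivAt x h1
  rw [((hc k).fun_mul hcut).fderiv, ((hc j).fun_mul hcut).fderiv]
  simp [hjk, hjk.symm, EuclideanSpace.inner_single_right]
  ring

theorem tendsto_integral_cutoff {f : Pt d → ℂ} (hf : Integrable f) :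
    Tendsto (fun n => ∫ x, (cutoff n x : ℂ) * f x) atTop (𝓝 (∫ x, f x)) := by
  refine tendsto_integral_of_dominated_convergence (fun x => ‖f x‖) (fun n => ?_) hf.norm
    (fun n => ae_of_all _ fun x => ?_) (ae_of_all _ fun x => ?_)
  · exact (Complex.continuous_ofReal.comp (contDiff_cutoff n).continuous).aestronglyMeasurable.mul
      hf.aestronglyMeasurable
  · rw [norm_mul, Complex.norm_real, Real.norm_of_nonneg (cutoff_nonneg n x)]
    exact mul_le_of_le_one_left (norm_nonneg _) (cutoff_le_one n x)
  · have := ((Complex.continuous_ofReal.tendsto _).comp (tendsto_cutoff x)).mul_const (f x)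
    simpa using this

/-- The angular momentum is a symmetric operator: the rotation field is divergence free. -/
theorem integral_rotation_eq_neg {j k : Fin d} (hjk : j ≠ k) {u gj gk v hj hk : L2 d}
    (huj : HasWeakPartial j u gj) (huk : HasWeakPartial k u gk)
    (hvj : HasWeakPartial j v hj) (hvk : HasWeakPartial k v hk)
    (muj : MemLp (fun x : Pt d => (x j : ℂ) * u x) 2 volume)
    (muk : MemLp (fun x : Pt d => (x k : ℂ) * u x) 2 volume)
    (mvj : MemLp (fun x : Pt d => (x j : ℂ) * v x) 2 volume)
    (mvk : MemLp (fun x : Pt d => (x k : ℂ) * v x) 2 volume) :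
    (∫ x, conj (gj x) * ((x k : ℂ) * v x)) - ∫ x, conj (gk x) * ((x j : ℂ) * v x)
      = -((∫ x, conj ((x k : ℂ) * u x) * hj x) - ∫ x, conj ((x j : ℂ) * u x) * hk x) := by
  have i1 := (Lp.memLp gj).star.integrable_mul mvk
  have i2 := (Lp.memLp gk).star.integrable_mul mvj
  have i3 := muk.star.integrable_mul (Lp.memLp hj)
  have i4 := muj.star.integrable_mul (Lp.memLp hk)
  refine tendsto_nhds_unique ((tendsto_integral_cutoff i1).sub (tendsto_integral_cutoff i2))
    (((tendsto_integral_cutoff i3).sub (tendsto_integral_cutoff i4)).neg.congr fun n => ?_)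
  have hs : ∀ l : Fin d, ContDiff ℝ ∞ (fun y : Pt d => y l * cutoff n y) := fun l =>
    (EuclideanSpace.proj l : Pt d →L[ℝ] ℝ).contDiff.mul (contDiff_cutoff n)
  have hcs : ∀ l : Fin d, HasCompactSupport (fun y : Pt d => y l * cutoff n y) := fun l =>
    (hasCompactSupport_cutoff n).mul_left
  have e1 := integral_weakPartial_mul huj hvj (hs k) (hcs k)
  have e2 := integral_weakPartial_mul huk hvk (hs j) (hcs j)
  simp_rw [fderiv_coord_mul_cutoff hjk n] at e1
  have r1 : ∀ (f : Pt d → ℂ) (w : L2 d) (l : Fin d),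
      ∫ x, conj (f x) * (((x l * cutoff n x : ℝ) : ℂ) * w x)
        = ∫ x, (cutoff n x : ℂ) * (conj (f x) * ((x l : ℂ) * w x)) := by
    intro f w l; congr 1; ext x; push_cast; ring
  have r2 : ∀ (w : L2 d) (l : Fin d),
      ∫ x, (cutoff n x : ℂ) * (conj (u x) * ((x l : ℂ) * w x))
        = ∫ x, (cutoff n x : ℂ) * (conj ((x l : ℂ) * u x) * w x) := by
    intro w l; congr 1; ext x; rw [map_mul, Complex.conj_ofReal]; ring
  rw [r1, r1, r2] at e1 e2
  show -((∫ x, (cutoff n x : ℂ) * (conj ((x k : ℂ) * u x) * hj x))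
      - ∫ x, (cutoff n x : ℂ) * (conj ((x j : ℂ) * u x) * hk x))
    = (∫ x, (cutoff n x : ℂ) * (conj (gj x) * ((x k : ℂ) * v x)))
      - ∫ x, (cutoff n x : ℂ) * (conj (gk x) * ((x j : ℂ) * v x))
  rw [e1, e2]
  ring

/-- The symmetry of the angular momentum, for functions whose products with the coordinates are
given as elements of `L²`. -/
theorem inner_rotation_eq_neg {j k : Fin d} (hjk : j ≠ k) {u gj gk v hj hk uj uk vj vk : L2 d}
    (huj : HasWeakPartial j u gj) (huk : HasWeakPartial k u gk)
    (hvj : HasWeakPartial j v hj) (hvk : HasWeakPartial k v hk)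
    (euj : uj =ᵐ[volume] fun x => (x j : ℂ) * u x) (euk : uk =ᵐ[volume] fun x => (x k : ℂ) * u x)
    (evj : vj =ᵐ[volume] fun x => (x j : ℂ) * v x) (evk : vk =ᵐ[volume] fun x => (x k : ℂ) * v x) :
    inner ℂ gj vk - inner ℂ gk vj = -(inner ℂ uk hj - inner ℂ uj hk) := by
  have key := integral_rotation_eq_neg hjk huj huk hvj hvk ((memLp_congr_ae euj).mp (Lp.memLp uj))
    ((memLp_congr_ae euk).mp (Lp.memLp uk)) ((memLp_congr_ae evj).mp (Lp.memLp vj))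
    ((memLp_congr_ae evk).mp (Lp.memLp vk))
  have e1 : ∀ (f w w' : L2 d) (l : Fin d), (w' =ᵐ[volume] fun x => (x l : ℂ) * w x) →
      inner ℂ f w' = ∫ x, conj (f x) * ((x l : ℂ) * w x) := by
    intro f w w' l h
    rw [L2.inner_def]
    apply integral_congr_ae
    filter_upwards [h] with x hx
    rw [hx, RCLike.inner_apply, mul_comm]
  have e2 : ∀ (f w w' : L2 d) (l : Fin d), (w' =ᵐ[volume] fun x => (x l : ℂ) * w x) →
      inner ℂ w' f = ∫ x, conj ((x l : ℂ) * w x) * f x := by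
    intro f w w' l h
    rw [L2.inner_def]
    apply integral_congr_ae
    filter_upwards [h] with x hx
    rw [hx, RCLike.inner_apply, mul_comm]
  rw [e1 gj v vk k evk, e1 gk v vj j evj, e2 hj u uk k euk, e2 hk u uj j euj]
  exact key

/-! ### The quadratic form on the energy space -/

/-- The first coordinate, or `0` in dimension one. -/
def coordX (x : Pt d) : ℝ := if h : 2 ≤ d then x ⟨0, by omega⟩ else 0

/-- The second coordinate, or `0` in dimension one. -/
def coordY (x : Pt d) : ℝ := if h : 2 ≤ d then x ⟨1, by omega⟩ else 0

theorem coord_sq_add_sq (x : Pt d) : coordX x ^ 2 + coordY x ^ 2 = axisDistSq x := by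
  unfold coordX coordY axisDistSq
  split_ifs <;> simp

theorem measurable_coordX : Measurable (coordX : Pt d → ℝ) := by
  unfold coordX
  split_ifs <;> fun_prop

theorem measurable_coordY : Measurable (coordY : Pt d → ℝ) := by
  unfold coordY
  split_ifs <;> fun_prop

/-- Multiplication by a real function, on a space of `L²` functions that it maps into `L²`. -/
def mulMap (S : Submodule ℂ (L2 d)) (m : Pt d → ℝ)
    (h : ∀ u ∈ S, MemLp (fun x => (m x : ℂ) * u x) 2 volume) : S →ₗ[ℂ] L2 d where
  toFun u := (h u u.2).toLp _
  map_add' u v := by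
    apply Lp.ext
    filter_upwards [(h _ (u + v).2).coeFn_toLp, (h _ u.2).coeFn_toLp, (h _ v.2).coeFn_toLp,
      Lp.coeFn_add ((h _ u.2).toLp _) ((h _ v.2).toLp _), Lp.coeFn_add (u : L2 d) v]
      with x h1 h2 h3 h4 h5
    rw [h1, h4, Pi.add_apply, h2, h3, Submodule.coe_add, h5, Pi.add_apply, mul_add]
  map_smul' c u := by
    apply Lp.ext
    filter_upwards [(h _ (c • u).2).coeFn_toLp, (h _ u.2).coeFn_toLp,
      Lp.coeFn_smul c ((h _ u.2).toLp _), Lp.coeFn_smul c (u : L2 d)]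
      with x h1 h2 h3 h4
    rw [h1, RingHom.id_apply, h3, Pi.smul_apply, h2, Submodule.coe_smul, h4, Pi.smul_apply,
      smul_eq_mul, smul_eq_mul]
    ring

theorem mulMap_coeFn (S : Submodule ℂ (L2 d)) (m : Pt d → ℝ)
    (h : ∀ u ∈ S, MemLp (fun x => (m x : ℂ) * u x) 2 volume) (u : S) :
    mulMap S m h u =ᵐ[volume] fun x => (m x : ℂ) * (u : L2 d) x :=
  (h u u.2).coeFn_toLp

theorem norm_mulMap_sq (S : Submodule ℂ (L2 d)) (m : Pt d → ℝ)
    (h : ∀ u ∈ S, MemLp (fun x => (m x : ℂ) * u x) 2 volume) (u : S) :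
    ‖mulMap S m h u‖ ^ 2 = ∫ x, m x ^ 2 * ‖(u : L2 d) x‖ ^ 2 := by
  rw [norm_sq_eq_integral]
  apply integral_congr_ae
  filter_upwards [mulMap_coeFn S m h u] with x hx
  rw [hx, norm_mul, Complex.norm_real, mul_pow, Real.norm_eq_abs, sq_abs]

theorem integrable_mulMap_sq (S : Submodule ℂ (L2 d)) (m : Pt d → ℝ)
    (h : ∀ u ∈ S, MemLp (fun x => (m x : ℂ) * u x) 2 volume) (u : S) :
    Integrable fun x => m x ^ 2 * ‖(u : L2 d) x‖ ^ 2 := by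
  refine (integrable_norm_sq (mulMap S m h u)).congr ?_
  filter_upwards [mulMap_coeFn S m h u] with x hx
  rw [hx, norm_mul, Complex.norm_real, mul_pow, Real.norm_eq_abs, sq_abs]

theorem memLp_mul_iff {m : Pt d → ℝ} (hm : Measurable m) (u : L2 d) :
    MemLp (fun x => (m x : ℂ) * u x) 2 volume ↔
      Integrable (fun x => m x ^ 2 * ‖u x‖ ^ 2) := by
  rw [memLp_two_iff_integrable_sq_norm]
  · refine integrable_congr (ae_of_all _ fun x => ?_)
    simp [mul_pow]
  · exact (Complex.measurable_ofReal.comp hm).aestronglyMeasurable.mul (Lp.aestronglyMeasurable u)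

/-- The data of a nonnegative potential that dominates the centrifugal potential of some speed `γ`
larger than `|Ω|`, up to a constant. -/
structure SubcriticalRotation (V : Pt d → ℝ) (Ω : ℝ) where
  measurable : Measurable V
  nonneg : ∀ x, 0 ≤ V x
  /-- A rotation speed larger than `|Ω|` whose centrifugal potential is dominated by `V`. -/
  γ : ℝ
  /-- The constant up to which `V` dominates that centrifugal potential. -/
  C₀ : ℝ
  abs_lt : |Ω| < γ
  C₀_nonneg : 0 ≤ C₀
  le_potential : ∀ x, γ ^ 2 / 2 * axisDistSq x ≤ V x + C₀

namespace SubcriticalRotation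

variable {V : Pt d → ℝ} {Ω : ℝ}

theorem γ_pos (S : SubcriticalRotation V Ω) : 0 < S.γ := (abs_nonneg Ω).trans_lt S.abs_lt

theorem sqrt_sq (S : SubcriticalRotation V Ω) (x : Pt d) : Real.sqrt (V x) ^ 2 = V x :=
  Real.sq_sqrt (S.nonneg x)

theorem integrable_iff (S : SubcriticalRotation V Ω) (u : L2 d) :
    Integrable (fun x => V x * ‖u x‖ ^ 2) ↔
      MemLp (fun x => (Real.sqrt (V x) : ℂ) * u x) 2 volume := by
  rw [memLp_mul_iff S.measurable.sqrt]
  simp_rw [S.sqrt_sq]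

/-- The energy space `X` as a subspace of `L²`. -/
def space (S : SubcriticalRotation V Ω) : Submodule ℂ (L2 d) where
  carrier := X V
  zero_mem' := by
    refine ⟨fun i => ⟨0, hasWeakPartial_zero i⟩, (integrable_zero _ _ _).congr ?_⟩
    filter_upwards [Lp.coeFn_zero ℂ 2 (volume : Measure (Pt d))] with x hx
    rw [hx]; simp
  add_mem' := by
    rintro u v ⟨hu, hVu⟩ ⟨hv, hVv⟩
    refine ⟨fun i => ⟨_, (hasWeakPartial_weakPartial hu i).add (hasWeakPartial_weakPartial hv i)⟩,
      ?_⟩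
    rw [S.integrable_iff] at *
    refine (hVu.add hVv).ae_eq ?_
    filter_upwards [Lp.coeFn_add u v] with x hx
    rw [hx, Pi.add_apply, Pi.add_apply, mul_add]
  smul_mem' := by
    rintro c u ⟨hu, hVu⟩
    refine ⟨fun i => ⟨_, (hasWeakPartial_weakPartial hu i).smul c⟩, ?_⟩
    rw [S.integrable_iff] at *
    refine (hVu.const_smul c).ae_eq ?_
    filter_upwards [Lp.coeFn_smul c u] with x hx
    rw [hx, Pi.smul_apply, Pi.smul_apply, smul_eq_mul, smul_eq_mul]
    ring

/-- The weak partial derivative as a linear map on the energy space. -/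
def grad (S : SubcriticalRotation V Ω) (i : Fin d) : S.space →ₗ[ℂ] L2 d where
  toFun u := weakPartial i u
  map_add' u v := weakPartial_eq
    ((hasWeakPartial_weakPartial u.2.1 i).add (hasWeakPartial_weakPartial v.2.1 i))
  map_smul' c u := weakPartial_eq ((hasWeakPartial_weakPartial u.2.1 i).smul c)

theorem hasWeakPartial_grad (S : SubcriticalRotation V Ω) (i : Fin d) (u : S.space) :
    HasWeakPartial i u (S.grad i u) :=
  hasWeakPartial_weakPartial u.2.1 i

/-- `u ↦ √V u` as a linear map on the energy space. -/
def pot (S : SubcriticalRotation V Ω) : S.space →ₗ[ℂ] L2 d :=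
  mulMap S.space (fun x => Real.sqrt (V x)) fun u hu => (S.integrable_iff u).mp hu.2

theorem norm_pot_sq (S : SubcriticalRotation V Ω) (u : S.space) :
    ‖S.pot u‖ ^ 2 = ∫ x, V x * ‖(u : L2 d) x‖ ^ 2 := by
  rw [pot, norm_mulMap_sq]
  simp_rw [S.sqrt_sq]

theorem integrable_axisDistSq (S : SubcriticalRotation V Ω) {u : L2 d} (hu : u ∈ S.space) :
    Integrable fun x => axisDistSq x * ‖u x‖ ^ 2 := by
  have hγ := S.γ_pos
  refine Integrable.mono' (g := fun x => 2 / S.γ ^ 2 * (V x * ‖u x‖ ^ 2 + S.C₀ * ‖u x‖ ^ 2))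
    ((hu.2.add ((integrable_norm_sq u).const_mul _)).const_mul _) ?_ (ae_of_all _ fun x => ?_)
  · have : Measurable (axisDistSq : Pt d → ℝ) := by
      have h : (axisDistSq : Pt d → ℝ) = fun x => coordX x ^ 2 + coordY x ^ 2 := by
        ext x; rw [coord_sq_add_sq]
      rw [h]
      exact (measurable_coordX.pow_const 2).add (measurable_coordY.pow_const 2)
    exact this.aestronglyMeasurable.mul (integrable_norm_sq u).aestronglyMeasurable
  · have h0 : 0 ≤ axisDistSq x := by rw [← coord_sq_add_sq]; positivity
    rw [Real.norm_of_nonneg (by positivity)]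
    have h1 : axisDistSq x ≤ 2 / S.γ ^ 2 * (V x + S.C₀) := by
      rw [div_mul_eq_mul_div, le_div_iff₀ (by positivity)]
      linarith [S.le_potential x]
    calc axisDistSq x * ‖u x‖ ^ 2 ≤ 2 / S.γ ^ 2 * (V x + S.C₀) * ‖u x‖ ^ 2 := by gcongr
      _ = _ := by ring

theorem memLp_coordX (S : SubcriticalRotation V Ω) {u : L2 d} (hu : u ∈ S.space) :
    MemLp (fun x => (coordX x : ℂ) * u x) 2 volume := by
  rw [memLp_mul_iff measurable_coordX]
  refine (S.integrable_axisDistSq hu).mono'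
    ((measurable_coordX.pow_const 2).aestronglyMeasurable.mul
      (integrable_norm_sq u).aestronglyMeasurable) (ae_of_all _ fun x => ?_)
  rw [Real.norm_of_nonneg (by positivity), ← coord_sq_add_sq]
  gcongr
  linarith [sq_nonneg (coordY x)]

theorem memLp_coordY (S : SubcriticalRotation V Ω) {u : L2 d} (hu : u ∈ S.space) :
    MemLp (fun x => (coordY x : ℂ) * u x) 2 volume := by
  rw [memLp_mul_iff measurable_coordY]
  refine (S.integrable_axisDistSq hu).mono'
    ((measurable_coordY.pow_const 2).aestronglyMeasurable.mul
      (integrable_norm_sq u).aestronglyMeasurable) (ae_of_all _ fun x => ?_)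
  rw [Real.norm_of_nonneg (by positivity), ← coord_sq_add_sq]
  gcongr
  linarith [sq_nonneg (coordX x)]

/-- Multiplication by the first coordinate (by `0` in dimension one). -/
def mulX (S : SubcriticalRotation V Ω) : S.space →ₗ[ℂ] L2 d :=
  mulMap S.space coordX fun _ => S.memLp_coordX

/-- Multiplication by the second coordinate (by `0` in dimension one). -/
def mulY (S : SubcriticalRotation V Ω) : S.space →ₗ[ℂ] L2 d :=
  mulMap S.space coordY fun _ => S.memLp_coordY

theorem mulX_coeFn (S : SubcriticalRotation V Ω) (u : S.space) :
    S.mulX u =ᵐ[volume] fun x => (coordX x : ℂ) * (u : L2 d) x :=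
  mulMap_coeFn _ _ _ u

theorem mulY_coeFn (S : SubcriticalRotation V Ω) (u : S.space) :
    S.mulY u =ᵐ[volume] fun x => (coordY x : ℂ) * (u : L2 d) x :=
  mulMap_coeFn _ _ _ u

theorem pot_coeFn (S : SubcriticalRotation V Ω) (u : S.space) :
    S.pot u =ᵐ[volume] fun x => (Real.sqrt (V x) : ℂ) * (u : L2 d) x :=
  mulMap_coeFn _ _ _ u

/-- The weak derivative `∂₁`, or `0` in dimension one. -/
def gradX (S : SubcriticalRotation V Ω) : S.space →ₗ[ℂ] L2 d :=
  if h : 2 ≤ d then S.grad ⟨0, by omega⟩ else 0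

/-- The weak derivative `∂₂`, or `0` in dimension one. -/
def gradY (S : SubcriticalRotation V Ω) : S.space →ₗ[ℂ] L2 d :=
  if h : 2 ≤ d then S.grad ⟨1, by omega⟩ else 0

/-- The matrix element `∫ (L_z u) v̄` of the angular momentum. -/
def angForm (S : SubcriticalRotation V Ω) (u v : S.space) : ℂ :=
  Complex.I * (inner ℂ (S.mulY v) (S.gradX u) - inner ℂ (S.mulX v) (S.gradY u))

/-- The sesquilinear form of `-½ Δ + V - Ω L_z`, conjugate-linear in the second argument. -/
def form (S : SubcriticalRotation V Ω) (u v : S.space) : ℂ :=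
  1 / 2 * (∑ i, inner ℂ (S.grad i v) (S.grad i u)) + inner ℂ (S.pot v) (S.pot u)
    - Ω * S.angForm u v

theorem Lz_ae_eq (S : SubcriticalRotation V Ω) (u : S.space) : (Lz (u : L2 d)) =ᵐ[volume]
    fun x => Complex.I * ((coordY x : ℂ) * S.gradX u x - (coordX x : ℂ) * S.gradY u x) := by
  by_cases h : 2 ≤ d
  · refine ae_of_all _ fun x => ?_
    simp only [Lz, coordX, coordY, gradX, gradY, h, dite_true]
    rfl
  · refine ae_of_all _ fun x => ?_
    simp only [Lz, coordX, coordY, h, dite_false]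
    simp

theorem integral_Lz_mul_conj (S : SubcriticalRotation V Ω) (u v : S.space) :
    ∫ x, Lz (u : L2 d) x * conj ((v : L2 d) x) = S.angForm u v := by
  have i1 := L2.integrable_inner (𝕜 := ℂ) (S.mulY v) (S.gradX u)
  have i2 := L2.integrable_inner (𝕜 := ℂ) (S.mulX v) (S.gradY u)
  rw [angForm, L2.inner_def, L2.inner_def, ← integral_sub i1 i2, ← integral_const_mul]
  apply integral_congr_ae
  filter_upwards [S.Lz_ae_eq u, S.mulX_coeFn v, S.mulY_coeFn v] with x h1 h2 h3
  rw [h1, h2, h3]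
  simp only [RCLike.inner_apply, map_mul, Complex.conj_ofReal]
  ring

theorem integral_pot_mul_conj (S : SubcriticalRotation V Ω) (u v : S.space) :
    ∫ x, (V x : ℂ) * (u : L2 d) x * conj ((v : L2 d) x) = inner ℂ (S.pot v) (S.pot u) := by
  rw [L2.inner_def]
  apply integral_congr_ae
  filter_upwards [S.pot_coeFn u, S.pot_coeFn v] with x h1 h2
  rw [h1, h2]
  simp only [RCLike.inner_apply, map_mul, Complex.conj_ofReal]
  have : (V x : ℂ) = (Real.sqrt (V x) : ℂ) * (Real.sqrt (V x) : ℂ) := by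
    rw [← Complex.ofReal_mul, Real.mul_self_sqrt (S.nonneg x)]
  rw [this]
  ring

theorem integral_grad_mul_conj (S : SubcriticalRotation V Ω) (i : Fin d) (u v : S.space) :
    ∫ x, weakPartial i (u : L2 d) x * conj (weakPartial i (v : L2 d) x)
      = inner ℂ (S.grad i v) (S.grad i u) := by
  rw [L2.inner_def]
  rfl

/-- `form` is the linear part of the weak form of the stationary equation, without the term in
`ω`. -/
theorem form_eq_integrals (S : SubcriticalRotation V Ω) (u v : S.space) :
    1 / 2 * (∑ i, ∫ x, weakPartial i (u : L2 d) x * conj (weakPartial i (v : L2 d) x))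
      + (∫ x, (V x : ℂ) * (u : L2 d) x * conj ((v : L2 d) x))
      - (Ω : ℂ) * (∫ x, Lz (u : L2 d) x * conj ((v : L2 d) x)) = S.form u v := by
  rw [S.integral_Lz_mul_conj, S.integral_pot_mul_conj, form]
  simp_rw [S.integral_grad_mul_conj]

theorem re_form_self (S : SubcriticalRotation V Ω) (u : S.space) : (S.form u u).re
    = 1 / 2 * (∑ i, ‖S.grad i u‖ ^ 2) + ‖S.pot u‖ ^ 2 - Ω * (S.angForm u u).re := by
  rw [form]
  have h : ∀ w : L2 d, inner ℂ w w = ((‖w‖ ^ 2 : ℝ) : ℂ) := fun w => by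
    rw [inner_self_eq_norm_sq_to_K]; simp
  simp_rw [h]
  rw [← Complex.ofReal_sum]
  have h2 : (1 / 2 : ℂ) = ((1 / 2 : ℝ) : ℂ) := by push_cast; rfl
  rw [h2, ← Complex.ofReal_mul, Complex.sub_re, Complex.add_re, Complex.ofReal_re,
    Complex.ofReal_re, Complex.re_ofReal_mul]

/-- The quadratic form of the energy is the diagonal of `form`. -/
theorem linForm_eq (S : SubcriticalRotation V Ω) (u : S.space) :
    linForm V Ω (u : L2 d) = (S.form u u).re := by
  rw [re_form_self, linForm, norm_pot_sq, ← integral_Lz_mul_conj]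
  simp_rw [mul_comm (conj _)]
  rfl

/-- The angular momentum is symmetric on the energy space. -/
theorem angForm_conj_symm (S : SubcriticalRotation V Ω) (u v : S.space) :
    conj (S.angForm u v) = S.angForm v u := by
  by_cases h : 2 ≤ d
  swap
  · simp [angForm, gradX, gradY, h]
  have hjk : (⟨0, by omega⟩ : Fin d) ≠ ⟨1, by omega⟩ := by simp [Fin.ext_iff]
  have hX : (coordX : Pt d → ℝ) = fun x => x ⟨0, by omega⟩ := by
    ext x; simp [coordX, h]
  have hY : (coordY : Pt d → ℝ) = fun x => x ⟨1, by omega⟩ := by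
    ext x; simp [coordY, h]
  have aX : ∀ u : S.space, S.mulX u =ᵐ[volume]
      fun x => (x ⟨0, by omega⟩ : ℂ) * (u : L2 d) x := fun u => by
    have := S.mulX_coeFn u
    simpa only [hX] using this
  have aY : ∀ u : S.space, S.mulY u =ᵐ[volume]
      fun x => (x ⟨1, by omega⟩ : ℂ) * (u : L2 d) x := fun u => by
    have := S.mulY_coeFn u
    simpa only [hY] using this
  have gX : S.gradX = S.grad ⟨0, by omega⟩ := by simp [gradX, h]
  have gY : S.gradY = S.grad ⟨1, by omega⟩ := by simp [gradY, h]
  have key := inner_rotation_eq_neg hjk (S.hasWeakPartial_grad _ u) (S.hasWeakPartial_grad _ u)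
    (S.hasWeakPartial_grad _ v) (S.hasWeakPartial_grad _ v) (aX u) (aY u) (aX v) (aY v)
  rw [← gX, ← gY] at key
  rw [angForm, angForm, map_mul, map_sub, inner_conj_symm, inner_conj_symm, Complex.conj_I, key]
  ring

theorem form_conj_symm (S : SubcriticalRotation V Ω) (u v : S.space) :
    conj (S.form u v) = S.form v u := by
  rw [form, form, map_sub, map_add, map_mul, map_mul, map_sum, angForm_conj_symm, inner_conj_symm,
    Complex.conj_ofReal]
  simp_rw [inner_conj_symm]
  have h2 : (starRingEnd ℂ) 2 = 2 := Complex.conj_ofNat 2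
  simp [h2]

theorem form_add_left (S : SubcriticalRotation V Ω) (u v w : S.space) :
    S.form (u + v) w = S.form u w + S.form v w := by
  simp only [form, angForm, map_add, inner_add_right, Finset.sum_add_distrib]
  ring

theorem form_smul_left (S : SubcriticalRotation V Ω) (c : ℂ) (u w : S.space) :
    S.form (c • u) w = c * S.form u w := by
  simp only [form, angForm, map_smul, inner_smul_right, ← Finset.mul_sum]
  ring

theorem form_add_right (S : SubcriticalRotation V Ω) (u v w : S.space) :
    S.form u (v + w) = S.form u v + S.form u w := by
  rw [← form_conj_symm, form_add_left, map_add, form_conj_symm, form_conj_symm]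

theorem form_smul_right (S : SubcriticalRotation V Ω) (c : ℂ) (u w : S.space) :
    S.form u (c • w) = conj c * S.form u w := by
  rw [← form_conj_symm, form_smul_left, map_mul, form_conj_symm]

/-- The potential energy controls the centrifugal energy at the speed `γ`. -/
theorem norm_mul_coord_le (S : SubcriticalRotation V Ω) (u : S.space) :
    S.γ ^ 2 / 2 * (‖S.mulX u‖ ^ 2 + ‖S.mulY u‖ ^ 2)
      ≤ ‖S.pot u‖ ^ 2 + S.C₀ * ‖(u : L2 d)‖ ^ 2 := by
  have iX := integrable_mulMap_sq S.space coordX (fun _ => S.memLp_coordX) u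
  have iY := integrable_mulMap_sq S.space coordY (fun _ => S.memLp_coordY) u
  rw [mulX, mulY, norm_mulMap_sq, norm_mulMap_sq, norm_pot_sq, norm_sq_eq_integral,
    ← integral_add iX iY, ← integral_const_mul, ← integral_const_mul,
    ← integral_add u.2.2 ((integrable_norm_sq _).const_mul _)]
  refine integral_mono ((iX.add iY).const_mul _)
    (u.2.2.add ((integrable_norm_sq _).const_mul _)) fun x => ?_
  have h1 := S.le_potential x
  rw [← coord_sq_add_sq] at h1
  have h2 := mul_le_mul_of_nonneg_right h1 (sq_nonneg ‖(u : L2 d) x‖)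
  show S.γ ^ 2 / 2 * (coordX x ^ 2 * _ + coordY x ^ 2 * _) ≤ V x * _ + S.C₀ * _
  linarith

/-- The kinetic and potential energies control the rotation term, since `|Ω| < γ`. -/
theorem le_re_form (S : SubcriticalRotation V Ω) (u : S.space) :
    (1 - |Ω| / S.γ) * (1 / 2 * (∑ i, ‖S.grad i u‖ ^ 2) + ‖S.pot u‖ ^ 2)
      ≤ (S.form u u).re + |Ω| / S.γ * S.C₀ * ‖(u : L2 d)‖ ^ 2 := by
  have hγ := S.γ_pos
  set θ := |Ω| / S.γ with hθ
  have hθ0 : 0 ≤ θ := by positivity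
  have hΩθ : |Ω| = θ * S.γ := by rw [hθ]; field_simp
  have hgrad : ‖S.gradX u‖ ^ 2 + ‖S.gradY u‖ ^ 2 ≤ ∑ i, ‖S.grad i u‖ ^ 2 := by
    by_cases h : 2 ≤ d
    · simp only [gradX, gradY, h, dite_true]
      have hjk : (⟨0, by omega⟩ : Fin d) ≠ ⟨1, by omega⟩ := by simp [Fin.ext_iff]
      rw [← Finset.sum_pair (f := fun i => ‖S.grad i u‖ ^ 2) hjk]
      exact Finset.sum_le_sum_of_subset_of_nonneg (Finset.subset_univ _)
        fun i _ _ => by positivity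
    · simp only [gradX, gradY, h, dite_false]
      simp
      positivity
  have hmul := S.norm_mul_coord_le u
  have hang : |(S.angForm u u).re| ≤ ‖S.mulY u‖ * ‖S.gradX u‖ + ‖S.mulX u‖ * ‖S.gradY u‖ := by
    refine (Complex.abs_re_le_norm _).trans ?_
    rw [angForm, norm_mul, Complex.norm_I, one_mul]
    refine (norm_sub_le _ _).trans (add_le_add ?_ ?_) <;> exact norm_inner_le_norm _ _
  have hΩang : Ω * (S.angForm u u).re ≤ θ * S.γ *
      (‖S.mulY u‖ * ‖S.gradX u‖ + ‖S.mulX u‖ * ‖S.gradY u‖) := by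
    rw [← hΩθ]
    refine (le_abs_self _).trans ?_
    rw [abs_mul]
    gcongr
  -- `γ a b ≤ ½ b² + ½ γ² a²`
  have h1 : S.γ * (‖S.mulY u‖ * ‖S.gradX u‖ + ‖S.mulX u‖ * ‖S.gradY u‖) ≤
      1 / 2 * (‖S.gradX u‖ ^ 2 + ‖S.gradY u‖ ^ 2)
      + S.γ ^ 2 / 2 * (‖S.mulX u‖ ^ 2 + ‖S.mulY u‖ ^ 2) := by
    generalize ‖S.gradX u‖ = a, ‖S.gradY u‖ = b, ‖S.mulX u‖ = x, ‖S.mulY u‖ = y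
    linarith [sq_nonneg (a - S.γ * y), sq_nonneg (b - S.γ * x)]
  have h2 := mul_le_mul_of_nonneg_left (h1.trans (add_le_add
    (mul_le_mul_of_nonneg_left hgrad (by norm_num)) hmul)) hθ0
  rw [re_form_self]
  linarith

end SubcriticalRotation

end Form

section Minimization

open scoped Topology

/-! ### Coercivity and convexity of the action -/

/-- The nonlinear part of the energy is finite on `H¹` for every subcritical `p`: there is an
admissible exponent `s` for `integrable_rpow_of_mem_H1` between `(d - 2) / 2` and `2 / (p - 1)`.
-/
theorem integrable_rpow_of_subcritical {p : ℝ} (hp : 1 < p)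
    (hpd : 3 ≤ d → p < ((d : ℝ) + 2) / ((d : ℝ) - 2)) {u : L2 d} (hu : u ∈ H1 d) :
    Integrable (fun x => ‖u x‖ ^ (p + 1)) := by
  have h1 : max 0 (((d : ℝ) - 2) / 2) < 2 / (p - 1) := by
    have hp1 : 0 < p - 1 := by linarith
    refine max_lt (by positivity) ?_
    rw [lt_div_iff₀ hp1]
    by_cases hd : 3 ≤ d
    · have h3 : (3 : ℝ) ≤ d := by exact_mod_cast hd
      have := hpd hd
      rw [lt_div_iff₀ (by linarith)] at this
      linarith
    · have h3 : (d : ℝ) ≤ 2 := by exact_mod_cast (by omega : d ≤ 2)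
      nlinarith
  obtain ⟨s, hs1, hs2⟩ := exists_between h1
  have hs0 : 0 < s := (le_max_left _ _).trans_lt hs1
  have hsd := (le_max_right _ _).trans_lt hs1
  refine integrable_rpow_of_mem_H1 hu hs0 (by linarith) (by linarith) ?_
  rw [lt_div_iff₀ (by linarith)] at hs2
  have : p - 1 < 2 / s := by
    rw [lt_div_iff₀ hs0]; linarith
  linarith

theorem exists_subseq_ae_tendsto {v : ℕ → L2 d} {U : L2 d} (h : Tendsto v atTop (𝓝 U)) :
    ∃ φ : ℕ → ℕ, StrictMono φ ∧ ∀ᵐ x, Tendsto (fun n => v (φ n) x) atTop (𝓝 (U x)) :=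
  (tendstoInMeasure_of_tendsto_Lp h).exists_seq_tendsto_ae

/-- Multiplication by a function is a closed operator in `L²`. -/
theorem ae_eq_mul_of_tendsto {m : Pt d → ℂ} {v f : ℕ → L2 d} {U F : L2 d}
    (h : ∀ n, f n =ᵐ[volume] fun x => m x * v n x)
    (hv : Tendsto v atTop (𝓝 U)) (hf : Tendsto f atTop (𝓝 F)) :
    F =ᵐ[volume] fun x => m x * U x := by
  obtain ⟨φ, hφ, h1⟩ := exists_subseq_ae_tendsto hv
  obtain ⟨ψ, hψ, h2⟩ := exists_subseq_ae_tendsto (hf.comp hφ.tendsto_atTop)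
  have h3 : ∀ᵐ x, ∀ n, f n x = m x * v n x := ae_all_iff.mpr h
  filter_upwards [h1, h2, h3] with x a b c
  refine tendsto_nhds_unique b ?_
  have := (a.comp hψ.tendsto_atTop).const_mul (m x)
  refine this.congr fun n => ?_
  exact (c _).symm

/-- Fatou's lemma for the nonlinear part of the energy. -/
theorem integral_rpow_le_of_tendsto {q : ℝ} (hq : 0 < q) {v : ℕ → L2 d} {U : L2 d}
    (hU : Integrable (fun x => ‖U x‖ ^ q))
    (hvi : ∀ n, Integrable (fun x => ‖v n x‖ ^ q)) (hv : Tendsto v atTop (𝓝 U)) {L : ℝ}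
    (hL : Tendsto (fun n => ∫ x, ‖v n x‖ ^ q) atTop (𝓝 L)) :
    ∫ x, ‖U x‖ ^ q ≤ L := by
  obtain ⟨φ, hφ, h1⟩ := exists_subseq_ae_tendsto hv
  have hL0 : 0 ≤ L := ge_of_tendsto' hL fun n => integral_nonneg fun x => by positivity
  rw [← ENNReal.ofReal_le_ofReal_iff hL0,
    ofReal_integral_eq_lintegral_ofReal hU (ae_of_all _ fun x => by positivity)]
  have h2 : ∀ᵐ x, ENNReal.ofReal (‖U x‖ ^ q)
      = liminf (fun n => ENNReal.ofReal (‖v (φ n) x‖ ^ q)) atTop := by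
    filter_upwards [h1] with x hx
    refine (Tendsto.liminf_eq ?_).symm
    exact ENNReal.tendsto_ofReal (hx.norm.rpow_const (Or.inr hq.le))
  rw [lintegral_congr_ae h2]
  refine (lintegral_liminf_le' fun n =>
    (hvi (φ n)).aestronglyMeasurable.aemeasurable.ennreal_ofReal).trans ?_
  have h3 : Tendsto (fun n => ∫⁻ x, ENNReal.ofReal (‖v (φ n) x‖ ^ q)) atTop
      (𝓝 (ENNReal.ofReal L)) := by
    refine (ENNReal.tendsto_ofReal (hL.comp hφ.tendsto_atTop)).congr fun n => ?_
    exact ofReal_integral_eq_lintegral_ofReal (hvi (φ n)) (ae_of_all _ fun x => by positivity)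
  exact h3.liminf_eq.le

theorem norm_midpoint_rpow_le {q : ℝ} (hq : 1 ≤ q) (a b : ℂ) :
    ‖(1 / 2 : ℂ) * (a + b)‖ ^ q ≤ 1 / 2 * ‖a‖ ^ q + 1 / 2 * ‖b‖ ^ q := by
  have h1 : ‖(1 / 2 : ℂ) * (a + b)‖ ≤ 1 / 2 * ‖a‖ + 1 / 2 * ‖b‖ := by
    rw [norm_mul, ← mul_add]
    have : ‖(1 / 2 : ℂ)‖ = 1 / 2 := by norm_num
    rw [this]
    gcongr
    exact norm_add_le a b
  refine (Real.rpow_le_rpow (norm_nonneg _) h1 (by linarith)).trans ?_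
  have := (convexOn_rpow hq).2 (Set.mem_Ici.mpr (norm_nonneg a)) (Set.mem_Ici.mpr (norm_nonneg b))
    (by norm_num : (0 : ℝ) ≤ 1 / 2) (by norm_num : (0 : ℝ) ≤ 1 / 2) (by norm_num)
  simpa only [smul_eq_mul] using this

/-- Young's inequality: the defocusing power dominates the square, up to a constant. -/
theorem exists_mul_sq_le {a K p : ℝ} (ha : 0 < a) (hK : 0 ≤ K) (hp : 1 < p) :
    ∃ M : ℝ, 0 ≤ M ∧ ∀ s : ℝ, 0 ≤ s → K * s ^ 2 ≤ a * s ^ (p + 1) + M := by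
  set s₀ := (K / a) ^ (1 / (p - 1)) with hs₀
  have hp1 : 0 < p - 1 := by linarith
  have hs₀0 : 0 ≤ s₀ := by positivity
  refine ⟨K * s₀ ^ 2, by positivity, fun s hs => ?_⟩
  rcases le_total s s₀ with h | h
  · have h1 : K * s ^ 2 ≤ K * s₀ ^ 2 := by gcongr
    have h2 : 0 ≤ a * s ^ (p + 1) := by positivity
    linarith
  · have h1 : K / a ≤ s ^ (p - 1) := by
      have := Real.rpow_le_rpow hs₀0 h hp1.le
      rwa [hs₀, ← Real.rpow_mul (by positivity), one_div_mul_cancel hp1.ne', Real.rpow_one] at this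
    have h2 : s ^ (p + 1) = s ^ (p - 1) * s ^ 2 := by
      rw [← Real.rpow_two, ← Real.rpow_add_of_nonneg hs hp1.le (by norm_num)]
      congr 1; ring
    rw [div_le_iff₀ ha] at h1
    have h3 : 0 ≤ K * s₀ ^ 2 := by positivity
    have h4 := mul_le_mul_of_nonneg_right h1 (sq_nonneg s)
    rw [h2]
    linarith

namespace SubcriticalRotation

variable {V : Pt d → ℝ} {Ω : ℝ}

theorem action_eq (S : SubcriticalRotation V Ω) (p ω : ℝ) (u : S.space) :
    action V p Ω ω (u : L2 d) = (S.form u u).re + ω * ‖(u : L2 d)‖ ^ 2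
      + 2 / (p + 1) * ∫ x, ‖(u : L2 d) x‖ ^ (p + 1) := by
  rw [action, energy, linForm_eq S]
  ring

theorem one_sub_pos (S : SubcriticalRotation V Ω) : 0 < 1 - |Ω| / S.γ := by
  rw [sub_pos, div_lt_one S.γ_pos]
  exact S.abs_lt

/-- The action is coercive. The negative term `ω ‖u‖²` is absorbed by the potential at infinity, and
by the defocusing nonlinearity on a bounded set. -/
theorem exists_le_action (S : SubcriticalRotation V Ω) (hV : Tendsto V (cocompact (Pt d)) atTop)
    {p : ℝ} (hp : 1 < p) (hint : ∀ u ∈ H1 d, Integrable (fun x => ‖(u : L2 d) x‖ ^ (p + 1)))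
    (ω : ℝ) :
    ∃ c M : ℝ, 0 < c ∧ ∀ u : S.space,
      c * (∑ i, ‖S.grad i u‖ ^ 2 + ‖S.pot u‖ ^ 2) + ‖(u : L2 d)‖ ^ 2
        ≤ action V p Ω ω (u : L2 d) + M := by
  set θ := |Ω| / S.γ with hθ
  have hθ0 : 0 ≤ θ := div_nonneg (abs_nonneg _) S.γ_pos.le
  have hθ1 : 0 < 1 - θ := S.one_sub_pos
  set c := (1 - θ) / 2 with hc
  have hc0 : 0 < c := by positivity
  set K := θ * S.C₀ + |ω| + 1 with hK
  have hK0 : 0 ≤ K := by have := S.C₀_nonneg; positivity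
  obtain ⟨R, hR⟩ : ∃ R : ℝ, ∀ x ∉ Metric.closedBall (0 : Pt d) R, K / c ≤ V x := by
    have h1 := hV.eventually (eventually_ge_atTop (K / c))
    obtain ⟨T, hT, hTc⟩ := mem_cocompact.mp h1
    obtain ⟨R, hR⟩ := hT.isBounded.subset_closedBall (0 : Pt d)
    exact ⟨R, fun x hx => hTc fun hxT => hx (hR hxT)⟩
  set B := Metric.closedBall (0 : Pt d) R
  obtain ⟨M₀, hM₀, hY⟩ := exists_mul_sq_le (a := 2 / (p + 1)) (by positivity) hK0 hp
  have hBi : Integrable (B.indicator fun _ => M₀) volume :=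
    (integrable_indicator_iff measurableSet_closedBall).mpr
      (integrableOn_const measure_closedBall_lt_top.ne)
  refine ⟨c, ∫ x, B.indicator (fun _ => M₀) x, hc0, fun u => ?_⟩
  have h1 : K * ‖(u : L2 d)‖ ^ 2 ≤ c * ‖S.pot u‖ ^ 2
      + 2 / (p + 1) * (∫ x, ‖(u : L2 d) x‖ ^ (p + 1)) + ∫ x, B.indicator (fun _ => M₀) x := by
    have i1 := u.2.2.const_mul c
    have i2 := (hint u u.2.1).const_mul (2 / (p + 1))
    have i12 : Integrable fun x => c * (V x * ‖(u : L2 d) x‖ ^ 2)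
        + 2 / (p + 1) * ‖(u : L2 d) x‖ ^ (p + 1) := i1.add i2
    rw [norm_pot_sq, norm_sq_eq_integral, ← integral_const_mul, ← integral_const_mul,
      ← integral_const_mul, ← integral_add i1 i2, ← integral_add i12 hBi]
    refine integral_mono ((integrable_norm_sq _).const_mul _) (i12.add hBi) fun x => ?_
    show K * ‖(u : L2 d) x‖ ^ 2 ≤ c * (V x * ‖(u : L2 d) x‖ ^ 2)
      + 2 / (p + 1) * ‖(u : L2 d) x‖ ^ (p + 1) + B.indicator (fun _ => M₀) x
    have hVx := S.nonneg x
    by_cases hx : x ∈ B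
    · rw [Set.indicator_of_mem hx]
      have := hY ‖(u : L2 d) x‖ (norm_nonneg _)
      have : 0 ≤ c * (V x * ‖(u : L2 d) x‖ ^ 2) := by positivity
      linarith
    · rw [Set.indicator_of_notMem hx]
      have h2 := hR x hx
      rw [div_le_iff₀ hc0] at h2
      have h3 := mul_le_mul_of_nonneg_right h2 (sq_nonneg ‖(u : L2 d) x‖)
      have : 0 ≤ 2 / (p + 1) * ‖(u : L2 d) x‖ ^ (p + 1) := by positivity
      linarith
  have h2 := S.le_re_form u
  rw [action_eq]
  have h3 : -(|ω| * ‖(u : L2 d)‖ ^ 2) ≤ ω * ‖(u : L2 d)‖ ^ 2 := by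
    rw [← neg_mul]
    exact mul_le_mul_of_nonneg_right (neg_abs_le ω) (sq_nonneg _)
  rw [← hθ] at h2
  have h4 : (1 - θ) * (1 / 2 * (∑ i, ‖S.grad i u‖ ^ 2) + ‖S.pot u‖ ^ 2)
      = c * (∑ i, ‖S.grad i u‖ ^ 2 + ‖S.pot u‖ ^ 2) + c * ‖S.pot u‖ ^ 2 := by
    rw [hc]; ring
  rw [h4] at h2
  rw [hK] at h1
  linarith

/-- The parallelogram identity for the quadratic form. -/
theorem re_form_midpoint (S : SubcriticalRotation V Ω) (u v : S.space) :
    (S.form ((1 / 2 : ℂ) • (u + v)) ((1 / 2 : ℂ) • (u + v))).re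
      = 1 / 2 * (S.form u u).re + 1 / 2 * (S.form v v).re
        - 1 / 4 * (S.form (u - v) (u - v)).re := by
  have hsub : u - v = u + (-1 : ℂ) • v := by rw [neg_one_smul, sub_eq_add_neg]
  have hhalf : conj (1 / 2 : ℂ) = 1 / 2 := by
    have h2 : (starRingEnd ℂ) 2 = 2 := Complex.conj_ofNat 2
    simp [h2]
  have : S.form ((1 / 2 : ℂ) • (u + v)) ((1 / 2 : ℂ) • (u + v))
      = ((1 / 2 : ℝ) : ℂ) * S.form u u + ((1 / 2 : ℝ) : ℂ) * S.form v v
        - ((1 / 4 : ℝ) : ℂ) * S.form (u - v) (u - v) := by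
    rw [hsub]
    simp only [form_smul_left, form_smul_right, form_add_left, form_add_right, hhalf, map_neg,
      map_one]
    push_cast
    ring
  rw [this]
  simp only [Complex.add_re, Complex.sub_re, Complex.re_ofReal_mul]

/-- Up to a multiple of the `L²` norm, the action is uniformly convex in the energy norm. -/
theorem action_midpoint_le (S : SubcriticalRotation V Ω) {p : ℝ} (hp : 1 < p)
    (hint : ∀ u ∈ H1 d, Integrable (fun x => ‖(u : L2 d) x‖ ^ (p + 1))) (ω : ℝ) (u v : S.space) :
    action V p Ω ω (((1 / 2 : ℂ) • (u + v) : S.space) : L2 d)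
      ≤ 1 / 2 * action V p Ω ω (u : L2 d) + 1 / 2 * action V p Ω ω (v : L2 d)
        - 1 / 4 * ((S.form (u - v) (u - v)).re + ω * ‖((u - v : S.space) : L2 d)‖ ^ 2) := by
  have hN : ∫ x, ‖(((1 / 2 : ℂ) • (u + v) : S.space) : L2 d) x‖ ^ (p + 1)
      ≤ 1 / 2 * (∫ x, ‖(u : L2 d) x‖ ^ (p + 1)) + 1 / 2 * ∫ x, ‖(v : L2 d) x‖ ^ (p + 1) := by
    have i1 := (hint u u.2.1).const_mul (1 / 2)
    have i2 := (hint v v.2.1).const_mul (1 / 2)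
    rw [← integral_const_mul, ← integral_const_mul, ← integral_add i1 i2]
    refine integral_mono_ae (hint _ ((1 / 2 : ℂ) • (u + v) : S.space).2.1) (i1.add i2) ?_
    filter_upwards [Lp.coeFn_smul (1 / 2 : ℂ) ((u : L2 d) + (v : L2 d)),
      Lp.coeFn_add (u : L2 d) (v : L2 d)]
      with x h1 h2
    rw [Submodule.coe_smul, Submodule.coe_add, h1, Pi.smul_apply, h2, Pi.add_apply, smul_eq_mul]
    exact norm_midpoint_rpow_le (by linarith) _ _
  have hn : ‖(((1 / 2 : ℂ) • (u + v) : S.space) : L2 d)‖ ^ 2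
      = 1 / 2 * ‖(u : L2 d)‖ ^ 2 + 1 / 2 * ‖(v : L2 d)‖ ^ 2
        - 1 / 4 * ‖((u - v : S.space) : L2 d)‖ ^ 2 := by
    have h1 := parallelogram_law_with_norm ℂ (u : L2 d) v
    rw [Submodule.coe_smul, Submodule.coe_add, Submodule.coe_sub, norm_smul]
    have : ‖(1 / 2 : ℂ)‖ = 1 / 2 := by norm_num
    rw [this]
    linarith
  rw [action_eq, action_eq, action_eq, re_form_midpoint, hn]
  have := mul_le_mul_of_nonneg_left hN (by positivity : 0 ≤ 2 / (p + 1))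
  linarith

end SubcriticalRotation

/-! ### Existence of a minimizer of the action -/

theorem cauchySeq_of_norm_sub_sq_le {E : Type*} [SeminormedAddCommGroup E] {f : ℕ → E}
    (h : ∀ ε > 0, ∃ N, ∀ n ≥ N, ∀ m ≥ N, ‖f n - f m‖ ^ 2 ≤ ε) : CauchySeq f := by
  rw [Metric.cauchySeq_iff]
  intro ε hε
  obtain ⟨N, hN⟩ := h (ε ^ 2 / 2) (by positivity)
  refine ⟨N, fun n hn m hm => ?_⟩
  rw [dist_eq_norm]
  refine lt_of_pow_lt_pow_left₀ 2 hε.le ((hN n hn m hm).trans_lt ?_)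
  have : 0 < ε ^ 2 := by positivity
  linarith

namespace SubcriticalRotation

variable {V : Pt d → ℝ} {Ω : ℝ}

/-- Convergence in `L²` and in the potential energy implies convergence of the products with the
coordinates. -/
theorem tendsto_coord (S : SubcriticalRotation V Ω) {u : ℕ → S.space} {U : S.space}
    (hu : Tendsto (fun n => (u n : L2 d)) atTop (𝓝 (U : L2 d)))
    (hp : Tendsto (fun n => S.pot (u n)) atTop (𝓝 (S.pot U))) :
    Tendsto (fun n => S.mulX (u n)) atTop (𝓝 (S.mulX U)) ∧
      Tendsto (fun n => S.mulY (u n)) atTop (𝓝 (S.mulY U)) := by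
  have hγ := S.γ_pos
  have h0 : Tendsto (fun n => 2 / S.γ ^ 2 * (‖S.pot (u n) - S.pot U‖ ^ 2
      + S.C₀ * ‖(u n : L2 d) - U‖ ^ 2)) atTop (𝓝 0) := by
    have h1 := (tendsto_iff_norm_sub_tendsto_zero.mp hp).pow 2
    have h2 := (tendsto_iff_norm_sub_tendsto_zero.mp hu).pow 2
    have := (h1.add (h2.const_mul S.C₀)).const_mul (2 / S.γ ^ 2)
    simpa using this
  have hb : ∀ n, ‖S.mulX (u n) - S.mulX U‖ ^ 2 + ‖S.mulY (u n) - S.mulY U‖ ^ 2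
      ≤ 2 / S.γ ^ 2 * (‖S.pot (u n) - S.pot U‖ ^ 2 + S.C₀ * ‖(u n : L2 d) - U‖ ^ 2) := by
    intro n
    have := S.norm_mul_coord_le (u n - U)
    rw [map_sub, map_sub, map_sub, Submodule.coe_sub] at this
    rw [div_mul_eq_mul_div, le_div_iff₀ (by positivity)]
    linarith
  have hsq : ∀ f : ℕ → L2 d, ∀ F : L2 d, (∀ n, ‖f n - F‖ ^ 2 ≤ 2 / S.γ ^ 2 *
      (‖S.pot (u n) - S.pot U‖ ^ 2 + S.C₀ * ‖(u n : L2 d) - U‖ ^ 2)) →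
      Tendsto f atTop (𝓝 F) := by
    intro f F hf
    rw [tendsto_iff_norm_sub_tendsto_zero]
    have h1 := squeeze_zero (fun n => sq_nonneg _) hf h0
    have h2 := (Real.continuous_sqrt.tendsto 0).comp h1
    rw [Real.sqrt_zero] at h2
    refine h2.congr fun n => ?_
    exact Real.sqrt_sq (norm_nonneg _)
  exact ⟨hsq _ _ fun n => by have := hb n; have := sq_nonneg ‖S.mulY (u n) - S.mulY U‖; linarith,
    hsq _ _ fun n => by have := hb n; have := sq_nonneg ‖S.mulX (u n) - S.mulX U‖; linarith⟩

/-- The quadratic form is continuous in the energy norm. -/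
theorem tendsto_form (S : SubcriticalRotation V Ω) {u : ℕ → S.space} {U : S.space}
    (hu : Tendsto (fun n => (u n : L2 d)) atTop (𝓝 (U : L2 d)))
    (hg : ∀ i, Tendsto (fun n => S.grad i (u n)) atTop (𝓝 (S.grad i U)))
    (hp : Tendsto (fun n => S.pot (u n)) atTop (𝓝 (S.pot U))) :
    Tendsto (fun n => S.form (u n) (u n)) atTop (𝓝 (S.form U U)) := by
  obtain ⟨hX, hY⟩ := S.tendsto_coord hu hp
  have gX : Tendsto (fun n => S.gradX (u n)) atTop (𝓝 (S.gradX U)) := by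
    by_cases h : 2 ≤ d
    · simp only [gradX, h, dite_true]; exact hg _
    · simp only [gradX, h, dite_false]; exact tendsto_const_nhds
  have gY : Tendsto (fun n => S.gradY (u n)) atTop (𝓝 (S.gradY U)) := by
    by_cases h : 2 ≤ d
    · simp only [gradY, h, dite_true]; exact hg _
    · simp only [gradY, h, dite_false]; exact tendsto_const_nhds
  unfold form angForm
  exact ((tendsto_const_nhds.mul (tendsto_finsetSum _ fun i _ => (hg i).inner (hg i))).add
    (hp.inner hp)).sub (tendsto_const_nhds.mul
      (tendsto_const_nhds.mul ((hY.inner gX).sub (hX.inner gY))))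

/-- The energy space is complete. -/
theorem exists_limit (S : SubcriticalRotation V Ω) {u : ℕ → S.space} {U : L2 d}
    (hu : Tendsto (fun n => (u n : L2 d)) atTop (𝓝 U))
    (hg : ∀ i, CauchySeq fun n => S.grad i (u n)) (hp : CauchySeq fun n => S.pot (u n)) :
    ∃ W : S.space, (W : L2 d) = U ∧
      (∀ i, Tendsto (fun n => S.grad i (u n)) atTop (𝓝 (S.grad i W))) ∧
      Tendsto (fun n => S.pot (u n)) atTop (𝓝 (S.pot W)) := by
  choose g hg' using fun i => cauchySeq_tendsto_of_complete (hg i)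
  obtain ⟨P, hP⟩ := cauchySeq_tendsto_of_complete hp
  have hw : ∀ i, HasWeakPartial i U (g i) := fun i =>
    HasWeakPartial.of_tendsto (fun n => S.hasWeakPartial_grad i (u n)) hu (hg' i)
  have hPU := ae_eq_mul_of_tendsto (fun n => S.pot_coeFn (u n)) hu hP
  have hUX : U ∈ S.space :=
    ⟨fun i => ⟨g i, hw i⟩, (S.integrable_iff U).mpr ((memLp_congr_ae hPU).mp (Lp.memLp P))⟩
  refine ⟨⟨U, hUX⟩, rfl, fun i => ?_, ?_⟩
  · have : S.grad i ⟨U, hUX⟩ = g i := weakPartial_eq (hw i)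
    rw [this]; exact hg' i
  · have : S.pot ⟨U, hUX⟩ = P := Lp.ext ((S.pot_coeFn _).trans hPU.symm)
    rw [this]; exact hP

/-- Sublevel sets of the action are relatively compact in `L²`. -/
theorem exists_subseq_of_action_le (S : SubcriticalRotation V Ω)
    (hV : Tendsto V (cocompact (Pt d)) atTop) {p : ℝ} (hp : 1 < p)
    (hint : ∀ u ∈ H1 d, Integrable (fun x => ‖(u : L2 d) x‖ ^ (p + 1))) {ω T : ℝ} {w : ℕ → S.space}
    (hT : ∀ n, action V p Ω ω (w n : L2 d) ≤ T) :
    ∃ (U : L2 d) (φ : ℕ → ℕ), StrictMono φ ∧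
      Tendsto (fun n => (w (φ n) : L2 d)) atTop (𝓝 U) := by
  obtain ⟨c, M, hc, hcoer⟩ := S.exists_le_action hV hp hint ω
  have hbound : ∀ n, c * (∑ i, ‖S.grad i (w n)‖ ^ 2 + ‖S.pot (w n)‖ ^ 2) + ‖(w n : L2 d)‖ ^ 2
      ≤ T + M := fun n => (hcoer (w n)).trans (add_le_add_left (hT n) M)
  have hgp : ∀ n, ∑ i, ‖S.grad i (w n)‖ ^ 2 + ‖S.pot (w n)‖ ^ 2 ≤ (T + M) / c := fun n => by
    rw [le_div_iff₀ hc]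
    have h1 := hbound n
    have h2 := sq_nonneg ‖(w n : L2 d)‖
    linarith
  have hnorm : ∀ n, ‖(w n : L2 d)‖ ≤ T + M + 1 := fun n => by
    have h1 := hbound n
    have h2 : 0 ≤ c * (∑ i, ‖S.grad i (w n)‖ ^ 2 + ‖S.pot (w n)‖ ^ 2) := by positivity
    have h3 := sq_nonneg (‖(w n : L2 d)‖ - 1 / 2)
    linarith
  have htwo : ∀ x y : L2 d, ‖x - y‖ ^ 2 ≤ 2 * ‖x‖ ^ 2 + 2 * ‖y‖ ^ 2 := by
    intro x y
    have h1 := parallelogram_law_with_norm ℂ x y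
    have h2 := sq_nonneg ‖x + y‖
    linarith
  have hTM : 0 ≤ (T + M) / c := le_trans (by positivity) (hgp 0)
  have hTM' : 0 ≤ T + M := by
    have := mul_nonneg hTM hc.le
    rwa [div_mul_cancel₀ _ hc.ne'] at this
  have hgrad : ∀ n m, ∑ i, ‖S.grad i (w n - w m)‖ ^ 2 ≤ 4 * ((T + M) / c) := by
    intro n m
    have h1 : ∑ i, ‖S.grad i (w n - w m)‖ ^ 2
        ≤ ∑ i, (2 * ‖S.grad i (w n)‖ ^ 2 + 2 * ‖S.grad i (w m)‖ ^ 2) := by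
      refine Finset.sum_le_sum fun i _ => ?_
      rw [map_sub]; exact htwo _ _
    rw [Finset.sum_add_distrib, ← Finset.mul_sum, ← Finset.mul_sum] at h1
    have := hgp n
    have := hgp m
    have := sq_nonneg ‖S.pot (w n)‖
    have := sq_nonneg ‖S.pot (w m)‖
    linarith
  have hpot : ∀ n m, ‖S.pot (w n - w m)‖ ^ 2 ≤ 4 * ((T + M) / c) := by
    intro n m
    rw [map_sub]
    have := htwo (S.pot (w n)) (S.pot (w m))
    have := hgp n
    have := hgp m
    have : 0 ≤ ∑ i, ‖S.grad i (w n)‖ ^ 2 := by positivity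
    have : 0 ≤ ∑ i, ‖S.grad i (w m)‖ ^ 2 := by positivity
    linarith
  refine exists_tendsto_subseq (u := fun n => (w n : L2 d))
    (M := T + M + 1 + 4 * ((T + M) / c)) hV S.nonneg
    (fun n m => (w n - w m).2) (fun n => (hnorm n).trans (by linarith))
    (fun n m => (hgrad n m).trans (by linarith)) (fun n m => ?_)
  have h1 := hpot n m
  rw [norm_pot_sq] at h1
  exact h1.trans (by linarith)

/-- By uniform convexity, a minimizing sequence of the action that is a Cauchy sequence in `L²` is
one in the energy space. -/
theorem cauchy_of_minimizing (S : SubcriticalRotation V Ω) {p : ℝ} (hp : 1 < p)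
    (hint : ∀ u ∈ H1 d, Integrable (fun x => ‖(u : L2 d) x‖ ^ (p + 1))) {ω I : ℝ}
    (hI : ∀ v : S.space, I ≤ action V p Ω ω (v : L2 d)) {v : ℕ → S.space}
    (hv : Tendsto (fun n => action V p Ω ω (v n : L2 d)) atTop (𝓝 I))
    (hc : CauchySeq fun n => (v n : L2 d)) {ε : ℝ} (hε : 0 < ε) :
    ∃ N, ∀ n ≥ N, ∀ m ≥ N,
      ∑ i, ‖S.grad i (v n) - S.grad i (v m)‖ ^ 2 + ‖S.pot (v n) - S.pot (v m)‖ ^ 2 ≤ ε := by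
  set θ := |Ω| / S.γ with hθ
  have hθ0 : 0 ≤ θ := div_nonneg (abs_nonneg _) S.γ_pos.le
  have hθ1 : 0 < 1 - θ := S.one_sub_pos
  have hC₀ := S.C₀_nonneg
  set K := θ * S.C₀ + |ω| with hK
  have hK0 : 0 ≤ K := by positivity
  -- `δ` bounds both the excess of the action over `I` and the squared `L²` distances
  set δ := (1 - θ) / 2 * ε / (4 + K) with hδ
  have hδ0 : 0 < δ := by positivity
  have h9 : (1 - θ) / 2 * ε = 4 * δ + K * δ := by
    rw [hδ]; field_simp
  obtain ⟨N₁, hN₁⟩ := eventually_atTop.mp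
    (hv.eventually (gt_mem_nhds (by linarith : I < I + δ)))
  obtain ⟨N₂, hN₂⟩ := Metric.cauchySeq_iff.mp hc (Real.sqrt δ) (Real.sqrt_pos.mpr hδ0)
  refine ⟨max N₁ N₂, fun n hn m hm => ?_⟩
  have h1 := hN₁ n (le_of_max_le_left hn)
  have h2 := hN₁ m (le_of_max_le_left hm)
  have h3 : ‖((v n - v m : S.space) : L2 d)‖ ^ 2 ≤ δ := by
    have := hN₂ n (le_of_max_le_right hn) m (le_of_max_le_right hm)
    rw [dist_eq_norm] at this
    rw [Submodule.coe_sub, ← Real.sq_sqrt hδ0.le]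
    exact pow_le_pow_left₀ (norm_nonneg _) this.le 2
  have h4 := S.action_midpoint_le hp hint ω (v n) (v m)
  have h5 := hI ((1 / 2 : ℂ) • (v n + v m))
  have h6 := S.le_re_form (v n - v m)
  simp_rw [map_sub] at h6
  have h7 : -(|ω| * ‖((v n - v m : S.space) : L2 d)‖ ^ 2)
      ≤ ω * ‖((v n - v m : S.space) : L2 d)‖ ^ 2 := by
    rw [← neg_mul]
    exact mul_le_mul_of_nonneg_right (neg_abs_le ω) (sq_nonneg _)
  have h8 : K * ‖((v n - v m : S.space) : L2 d)‖ ^ 2 ≤ K * δ := by gcongr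
  rw [← hθ] at h6
  have h11 := mul_nonneg (by linarith : 0 ≤ (1 - θ) / 2) (sq_nonneg ‖S.pot (v n) - S.pot (v m)‖)
  refine le_of_mul_le_mul_left (a := (1 - θ) / 2) ?_ (by linarith)
  rw [hK] at h8 h9
  linarith

/-- The direct method: the action attains its infimum over the energy space. -/
theorem exists_action_le (S : SubcriticalRotation V Ω) (hV : Tendsto V (cocompact (Pt d)) atTop)
    {p : ℝ} (hp : 1 < p) (hint : ∀ u ∈ H1 d, Integrable (fun x => ‖(u : L2 d) x‖ ^ (p + 1)))
    (ω : ℝ) :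
    ∃ u : S.space, ∀ v : S.space, action V p Ω ω (u : L2 d) ≤ action V p Ω ω (v : L2 d) := by
  obtain ⟨c, M, hc, hcoer⟩ := S.exists_le_action hV hp hint ω
  set A : S.space → ℝ := fun u => action V p Ω ω (u : L2 d) with hA
  have hbdd : BddBelow (Set.range A) := by
    refine ⟨-M, ?_⟩
    rintro _ ⟨u, rfl⟩
    have h1 := hcoer u
    have h2 : 0 ≤ c * (∑ i, ‖S.grad i u‖ ^ 2 + ‖S.pot u‖ ^ 2) + ‖(u : L2 d)‖ ^ 2 := by positivity
    show -M ≤ action V p Ω ω (u : L2 d)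
    linarith
  set I := sInf (Set.range A) with hI
  have hle : ∀ v, I ≤ A v := fun v => csInf_le hbdd ⟨v, rfl⟩
  obtain ⟨a, -, ha, hmem⟩ := exists_seq_tendsto_sInf (Set.range_nonempty A) hbdd
  choose w hw using hmem
  have hwlim : Tendsto (fun n => A (w n)) atTop (𝓝 I) := by simpa [hw] using ha
  obtain ⟨T, hT⟩ := hwlim.bddAbove_range
  obtain ⟨U, φ, hφ, hU⟩ := S.exists_subseq_of_action_le hV hp hint (w := w) fun n => hT ⟨n, rfl⟩
  obtain ⟨v, hv⟩ : ∃ v : ℕ → S.space, ∀ n, v n = w (φ n) := ⟨fun n => w (φ n), fun _ => rfl⟩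
  have hvlim : Tendsto (fun n => A (v n)) atTop (𝓝 I) := by
    simpa only [hv] using! hwlim.comp hφ.tendsto_atTop
  simp_rw [← hv] at hU
  have hcg : ∀ i, CauchySeq fun n => S.grad i (v n) := fun i =>
    cauchySeq_of_norm_sub_sq_le fun ε hε => by
      obtain ⟨N, hN⟩ := S.cauchy_of_minimizing hp hint hle hvlim hU.cauchySeq hε
      refine ⟨N, fun n hn m hm => le_trans ?_ (hN n hn m hm)⟩
      have := Finset.single_le_sum (f := fun i => ‖S.grad i (v n) - S.grad i (v m)‖ ^ 2)
        (fun i _ => by positivity) (Finset.mem_univ i)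
      have := sq_nonneg ‖S.pot (v n) - S.pot (v m)‖
      linarith
  have hcp : CauchySeq fun n => S.pot (v n) :=
    cauchySeq_of_norm_sub_sq_le fun ε hε => by
      obtain ⟨N, hN⟩ := S.cauchy_of_minimizing hp hint hle hvlim hU.cauchySeq hε
      refine ⟨N, fun n hn m hm => le_trans ?_ (hN n hn m hm)⟩
      have : 0 ≤ ∑ i, ‖S.grad i (v n) - S.grad i (v m)‖ ^ 2 := by positivity
      linarith
  obtain ⟨W, rfl, hWg, hWp⟩ := S.exists_limit hU hcg hcp
  -- the quadratic part converges, so the nonlinear part does, and Fatou's lemma bounds it below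
  have hform := (Complex.continuous_re.tendsto _).comp (S.tendsto_form hU hWg hWp)
  have hN : Tendsto (fun n => ∫ x, ‖(v n : L2 d) x‖ ^ (p + 1)) atTop
      (𝓝 ((p + 1) / 2 * (I - (S.form W W).re - ω * ‖(W : L2 d)‖ ^ 2))) := by
    have h1 := ((hvlim.sub hform).sub ((hU.norm.pow 2).const_mul ω)).const_mul ((p + 1) / 2)
    refine h1.congr fun n => ?_
    simp only [hA, action_eq, Function.comp]
    have : 0 < p + 1 := by linarith
    field_simp
    ring
  have hfatou := integral_rpow_le_of_tendsto (by linarith) (hint W W.2.1)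
    (fun n => hint (v n) (v n).2.1) hU hN
  refine ⟨W, fun z => le_trans ?_ (hle z)⟩
  rw [action_eq]
  have hp1 : 0 < p + 1 := by linarith
  have h1 := mul_le_mul_of_nonneg_left hfatou (by positivity : 0 ≤ 2 / (p + 1))
  have h2 : 2 / (p + 1) * ((p + 1) / 2 * (I - (S.form W W).re - ω * ‖(W : L2 d)‖ ^ 2))
      = I - (S.form W W).re - ω * ‖(W : L2 d)‖ ^ 2 := by field_simp
  linarith

end SubcriticalRotation

/-! ### The Euler–Lagrange equation and the ground states -/

theorem add_rpow_le_two_rpow_mul {q a b : ℝ} (hq : 0 ≤ q) (ha : 0 ≤ a) (hb : 0 ≤ b) :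
    (a + b) ^ q ≤ 2 ^ q * (a ^ q + b ^ q) := by
  rcases le_total a b with h | h
  · calc (a + b) ^ q ≤ (2 * b) ^ q := Real.rpow_le_rpow (by positivity) (by linarith) hq
      _ = 2 ^ q * b ^ q := Real.mul_rpow (by norm_num) hb
      _ ≤ _ := by
        have : 0 ≤ a ^ q := by positivity
        gcongr; linarith
  · calc (a + b) ^ q ≤ (2 * a) ^ q := Real.rpow_le_rpow (by positivity) (by linarith) hq
      _ = 2 ^ q * a ^ q := Real.mul_rpow (by norm_num) ha
      _ ≤ _ := by
        have : 0 ≤ b ^ q := by positivity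
        gcongr; linarith

theorem integrable_add_rpow {q : ℝ} (hq : 0 ≤ q) {u v : L2 d}
    (hu : Integrable fun x => ‖u x‖ ^ q) (hv : Integrable fun x => ‖v x‖ ^ q) :
    Integrable fun x => (‖u x‖ + ‖v x‖) ^ q := by
  refine ((hu.add hv).const_mul (2 ^ q)).mono' ?_ (ae_of_all _ fun x => ?_)
  · exact (((Lp.aestronglyMeasurable u).norm.add
      (Lp.aestronglyMeasurable v).norm).aemeasurable.pow_const q).aestronglyMeasurable
  · rw [Real.norm_of_nonneg (by positivity)]
    exact add_rpow_le_two_rpow_mul hq (norm_nonneg _) (norm_nonneg _)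

/-- The bound that dominates the derivative of the power along a line. -/
theorem rpow_sub_two_mul_le {q m : ℝ} (hq : 2 < q) {w v : ℂ} (hw : ‖w‖ ≤ m) (hv : ‖v‖ ≤ m) :
    ‖w‖ ^ (q - 2) * (‖w‖ * ‖v‖) ≤ m ^ q := by
  have hm : 0 ≤ m := (norm_nonneg _).trans hw
  have h1 : m ^ q = m ^ (q - 2) * (m * m) := by
    have : m * m = m ^ (2 : ℝ) := by rw [Real.rpow_two, sq]
    rw [this, ← Real.rpow_add_of_nonneg hm (by linarith) (by norm_num)]
    congr 1; ring
  rw [h1]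
  have h2 : ‖w‖ ^ (q - 2) ≤ m ^ (q - 2) := Real.rpow_le_rpow (norm_nonneg _) hw (by linarith)
  gcongr

theorem integrable_rpow_mul_mul_conj {p : ℝ} (hp : 1 < p) {u v : L2 d}
    (hu : Integrable fun x => ‖u x‖ ^ (p + 1)) (hv : Integrable fun x => ‖v x‖ ^ (p + 1)) :
    Integrable fun x => ((‖u x‖ ^ (p - 1) : ℝ) : ℂ) * u x * conj (v x) := by
  refine (integrable_add_rpow (by linarith) hu hv).mono' ?_ (ae_of_all _ fun x => ?_)
  · refine (AEStronglyMeasurable.mul ?_ (Lp.aestronglyMeasurable u)).mul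
      (Lp.aestronglyMeasurable v).star
    exact (Complex.measurable_ofReal.comp_aemeasurable
      ((Lp.aestronglyMeasurable u).norm.aemeasurable.pow_const _)).aestronglyMeasurable
  · rw [norm_mul, norm_mul, Complex.norm_real, Real.norm_of_nonneg (by positivity),
      RCLike.norm_conj, mul_assoc]
    have := rpow_sub_two_mul_le (q := p + 1) (m := ‖u x‖ + ‖v x‖) (by linarith) (w := u x)
      (v := v x) (by linarith [norm_nonneg (v x)]) (by linarith [norm_nonneg (u x)])
    convert this using 3
    ring

/-- The directional derivative of the nonlinear part of the energy. -/
theorem hasDerivAt_integral_rpow {p : ℝ} (hp : 1 < p) {u v : L2 d}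
    (hu : Integrable fun x => ‖u x‖ ^ (p + 1)) (hv : Integrable fun x => ‖v x‖ ^ (p + 1)) :
    HasDerivAt (fun t : ℝ => ∫ x, ‖u x + (t : ℂ) * v x‖ ^ (p + 1))
      ((p + 1) * (∫ x, ((‖u x‖ ^ (p - 1) : ℝ) : ℂ) * u x * conj (v x)).re) 0 := by
  have hmeas : ∀ t : ℝ, AEStronglyMeasurable (fun x => u x + (t : ℂ) * v x) volume := fun t =>
    (Lp.aestronglyMeasurable u).add ((Lp.aestronglyMeasurable v).const_mul _)
  have hder : ∀ x, ∀ t : ℝ, HasDerivAt (fun t : ℝ => ‖u x + (t : ℂ) * v x‖ ^ (p + 1))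
      ((p + 1) * ‖u x + (t : ℂ) * v x‖ ^ (p - 1) * inner ℝ (u x + (t : ℂ) * v x) (v x)) t := by
    intro x t
    have h1 : HasDerivAt (fun t : ℝ => u x + (t : ℂ) * v x) (v x) t := by
      simpa using ((Complex.ofRealCLM.hasDerivAt (x := t)).mul_const (v x)).const_add (u x)
    have h2 := (hasFDerivAt_norm_rpow (u x + (t : ℂ) * v x)
      (by linarith : 1 < p + 1)).comp_hasDerivAt t h1
    refine h2.congr_deriv ?_
    show (p + 1) * ‖u x + (t : ℂ) * v x‖ ^ (p + 1 - 2) * inner ℝ (u x + (t : ℂ) * v x) (v x) = _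
    rw [show p + 1 - 2 = p - 1 by ring]
  have key := (hasDerivAt_integral_of_dominated_loc_of_deriv_le (μ := volume)
    (F := fun (t : ℝ) x => ‖u x + (t : ℂ) * v x‖ ^ (p + 1))
    (F' := fun (t : ℝ) x => (p + 1) * ‖u x + (t : ℂ) * v x‖ ^ (p - 1)
      * inner ℝ (u x + (t : ℂ) * v x) (v x)) (x₀ := (0 : ℝ)) (s := Metric.ball 0 1)
    (bound := fun x => (p + 1) * (‖u x‖ + ‖v x‖) ^ (p + 1))
    (Metric.ball_mem_nhds _ one_pos)
    (Eventually.of_forall fun t => ((hmeas t).norm.aemeasurable.pow_const _).aestronglyMeasurable)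
    (by simpa using hu) ?_ ?_ ((integrable_add_rpow (by linarith) hu hv).const_mul _)
    (ae_of_all _ fun x t _ => hder x t)).2
  · refine key.congr_deriv (Eq.symm ?_)
    rw [← RCLike.re_eq_complex_re, ← integral_re (integrable_rpow_mul_mul_conj hp hu hv),
      ← integral_const_mul]
    congr 1; ext x
    simp only [Complex.ofReal_zero, zero_mul, add_zero, Complex.inner, RCLike.re_eq_complex_re]
    rw [mul_assoc, mul_assoc, Complex.re_ofReal_mul, ← Complex.conj_re (u x * conj (v x))]
    simp
    left; left; ring
  · exact (((hmeas 0).norm.aemeasurable.pow_const _).const_mul _).aestronglyMeasurable.mul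
      ((hmeas 0).inner (Lp.aestronglyMeasurable v))
  · refine ae_of_all _ fun x t ht => ?_
    have ht1 : |t| ≤ 1 := by
      have : |t| < 1 := by simpa using ht
      exact this.le
    have hw : ‖u x + (t : ℂ) * v x‖ ≤ ‖u x‖ + ‖v x‖ := by
      refine (norm_add_le _ _).trans ?_
      rw [norm_mul, Complex.norm_real, Real.norm_eq_abs]
      have := mul_le_of_le_one_left (norm_nonneg (v x)) ht1
      linarith
    have h1 := rpow_sub_two_mul_le (q := p + 1) (by linarith) hw
      (by linarith [norm_nonneg (u x)] : ‖v x‖ ≤ ‖u x‖ + ‖v x‖)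
    have h2 : p + 1 - 2 = p - 1 := by ring
    rw [h2] at h1
    have hp1 : 0 ≤ p + 1 := by linarith
    rw [norm_mul, norm_mul, Real.norm_of_nonneg hp1, Real.norm_of_nonneg (by positivity), mul_assoc]
    refine mul_le_mul_of_nonneg_left (le_trans ?_ h1) hp1
    gcongr
    exact norm_inner_le_norm _ _

namespace SubcriticalRotation

variable {V : Pt d → ℝ} {Ω : ℝ}

theorem integral_mul_conj (S : SubcriticalRotation V Ω) (u v : S.space) :
    ∫ x, (u : L2 d) x * conj ((v : L2 d) x) = inner ℂ (v : L2 d) (u : L2 d) := by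
  rw [L2.inner_def]
  rfl

theorem re_form_add_smul (S : SubcriticalRotation V Ω) (u v : S.space) (t : ℝ) :
    (S.form (u + (t : ℂ) • v) (u + (t : ℂ) • v)).re
      = (S.form u u).re + t * (2 * (S.form u v).re) + t ^ 2 * (S.form v v).re := by
  have h : S.form v u = conj (S.form u v) := (S.form_conj_symm u v).symm
  simp only [form_add_left, form_add_right, form_smul_left, form_smul_right, h, Complex.conj_ofReal]
  simp only [Complex.add_re, Complex.re_ofReal_mul, Complex.conj_re]
  ring

theorem norm_add_smul_sq (S : SubcriticalRotation V Ω) (u v : S.space) (t : ℝ) :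
    ‖((u + (t : ℂ) • v : S.space) : L2 d)‖ ^ 2
      = ‖(u : L2 d)‖ ^ 2 + t * (2 * (inner ℂ (v : L2 d) (u : L2 d)).re)
        + t ^ 2 * ‖(v : L2 d)‖ ^ 2 := by
  rw [Submodule.coe_add, Submodule.coe_smul, norm_add_sq (𝕜 := ℂ), inner_smul_right, norm_smul,
    Complex.norm_real, mul_pow, Real.norm_eq_abs, sq_abs, RCLike.re_eq_complex_re,
    Complex.re_ofReal_mul, ← inner_conj_symm, Complex.conj_re]
  ring

theorem integral_norm_add_smul_rpow (S : SubcriticalRotation V Ω) (q : ℝ) (u v : S.space) (t : ℝ) :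
    ∫ x, ‖((u + (t : ℂ) • v : S.space) : L2 d) x‖ ^ q
      = ∫ x, ‖(u : L2 d) x + (t : ℂ) * (v : L2 d) x‖ ^ q := by
  apply integral_congr_ae
  filter_upwards [Lp.coeFn_add (u : L2 d) ((t : ℂ) • (v : L2 d)),
    Lp.coeFn_smul (t : ℂ) (v : L2 d)] with x h1 h2
  rw [Submodule.coe_add, Submodule.coe_smul, h1, Pi.add_apply, h2, Pi.smul_apply, smul_eq_mul]

/-- The first variation of the action at `u` in the direction `v`. -/
theorem hasDerivAt_action (S : SubcriticalRotation V Ω) {p : ℝ} (hp : 1 < p)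
    (hint : ∀ u ∈ H1 d, Integrable (fun x => ‖(u : L2 d) x‖ ^ (p + 1))) (ω : ℝ) (u v : S.space) :
    HasDerivAt (fun t : ℝ => action V p Ω ω ((u + (t : ℂ) • v : S.space) : L2 d))
      (2 * (S.form u v
        + (∫ x, ((‖(u : L2 d) x‖ ^ (p - 1) : ℝ) : ℂ) * (u : L2 d) x * conj ((v : L2 d) x))
        + ω * inner ℂ (v : L2 d) (u : L2 d)).re) 0 := by
  have h1 := hasDerivAt_integral_rpow hp (hint u u.2.1) (hint v v.2.1)
  simp_rw [action_eq, re_form_add_smul, norm_add_smul_sq, integral_norm_add_smul_rpow]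
  have hpoly : ∀ a b c : ℝ, HasDerivAt (fun t : ℝ => a + t * b + t ^ 2 * c) b 0 := by
    intro a b c
    exact ((((hasDerivAt_id (0 : ℝ)).mul_const b).const_add a).add
      ((hasDerivAt_pow 2 (0 : ℝ)).mul_const c)).congr_deriv (by simp)
  have h2 := ((hpoly (S.form u u).re (2 * (S.form u v).re) (S.form v v).re).add
    ((hpoly (‖(u : L2 d)‖ ^ 2) (2 * (inner ℂ (v : L2 d) (u : L2 d)).re)
      (‖(v : L2 d)‖ ^ 2)).const_mul ω)).add (h1.const_mul (2 / (p + 1)))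
  refine h2.congr_deriv (Eq.symm ?_)
  simp only [Complex.add_re, Complex.re_ofReal_mul]
  have : p + 1 ≠ 0 := by linarith
  field_simp
  ring

/-- Minimizers of the action over the energy space solve the stationary equation. -/
theorem isStationary_of_minimizer (S : SubcriticalRotation V Ω) {p : ℝ} (hp : 1 < p)
    (hint : ∀ u ∈ H1 d, Integrable (fun x => ‖(u : L2 d) x‖ ^ (p + 1))) {ω : ℝ} {u : S.space}
    (hu : ∀ v : S.space, action V p Ω ω (u : L2 d) ≤ action V p Ω ω (v : L2 d)) :
    IsStationary V p Ω ω (u : L2 d) := by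
  set Z : S.space → ℂ := fun v => S.form u v
    + (∫ x, ((‖(u : L2 d) x‖ ^ (p - 1) : ℝ) : ℂ) * (u : L2 d) x * conj ((v : L2 d) x))
    + ω * inner ℂ (v : L2 d) (u : L2 d) with hZ
  have hre : ∀ v, (Z v).re = 0 := by
    intro v
    have hmin : IsLocalMin
        (fun t : ℝ => action V p Ω ω ((u + (t : ℂ) • v : S.space) : L2 d)) 0 := by
      refine Eventually.of_forall fun t => ?_
      simpa using hu (u + (t : ℂ) • v)
    have := hmin.hasDerivAt_eq_zero (S.hasDerivAt_action hp hint ω u v)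
    simpa [hZ] using this
  -- the imaginary part is the real part in the direction `i v`
  have hI : ∀ v, Z (Complex.I • v) = -Complex.I * Z v := by
    intro v
    have h1 : ∫ x, ((‖(u : L2 d) x‖ ^ (p - 1) : ℝ) : ℂ) * (u : L2 d) x
          * conj (((Complex.I • v : S.space) : L2 d) x)
        = -Complex.I * ∫ x, ((‖(u : L2 d) x‖ ^ (p - 1) : ℝ) : ℂ) * (u : L2 d) x
          * conj ((v : L2 d) x) := by
      rw [← integral_const_mul]
      apply integral_congr_ae
      filter_upwards [Lp.coeFn_smul Complex.I (v : L2 d)] with x hx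
      rw [Submodule.coe_smul, hx, Pi.smul_apply, smul_eq_mul, map_mul, Complex.conj_I]
      ring
    simp only [hZ]
    rw [h1, form_smul_right, Submodule.coe_smul, inner_smul_left, Complex.conj_I]
    ring
  intro v hv
  have hz : Z ⟨v, hv⟩ = 0 := by
    refine Complex.ext (hre _) ?_
    have := hre (Complex.I • ⟨v, hv⟩)
    rw [hI] at this
    simpa using this
  have h1 := S.form_eq_integrals u ⟨v, hv⟩
  have h2 := S.integral_mul_conj u ⟨v, hv⟩
  simp only [hZ] at hz
  rw [← h1, ← h2] at hz
  linear_combination hz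

/-- If the quadratic part of the action is negative in some direction, then the action takes
negative values, since the quadratic part dominates the nonlinearity near zero. -/
theorem exists_action_neg (S : SubcriticalRotation V Ω) {p : ℝ} (hp : 1 < p) {ω : ℝ} {u : S.space}
    (hu : linForm V Ω (u : L2 d) + ω * ‖(u : L2 d)‖ ^ 2 < 0) :
    ∃ v : S.space, action V p Ω ω (v : L2 d) < 0 := by
  rw [linForm_eq S] at hu
  set a := -((S.form u u).re + ω * ‖(u : L2 d)‖ ^ 2) with ha
  have ha0 : 0 < a := by linarith
  set b := 2 / (p + 1) * ∫ x, ‖(u : L2 d) x‖ ^ (p + 1) with hb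
  have hb0 : 0 ≤ b := mul_nonneg (by positivity) (integral_nonneg fun x => by positivity)
  -- `-a` and `b` are the quadratic and the nonlinear part at `u`; at `t u` they are `-a t²` and
  -- `b t ^ (p + 1)`, and `b + 1` instead of `b` keeps the denominator positive
  set t := (a / (2 * (b + 1))) ^ (1 / (p - 1)) with ht
  have ht0 : 0 < t := by positivity
  have htp : t ^ (p - 1) = a / (2 * (b + 1)) := by
    rw [ht, ← Real.rpow_mul (by positivity), one_div_mul_cancel (by linarith), Real.rpow_one]
  have h1 : (0 : S.space) + (t : ℂ) • u = (t : ℂ) • u := zero_add _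
  have h2 := S.re_form_add_smul 0 u t
  have h3 := S.norm_add_smul_sq 0 u t
  have hz : ∀ w : S.space, S.form 0 w = 0 := fun w => by
    have := S.form_smul_left 0 0 w
    simpa using this
  rw [h1] at h2 h3
  have h4 : ∫ x, ‖(((t : ℂ) • u : S.space) : L2 d) x‖ ^ (p + 1)
      = t ^ (p + 1) * ∫ x, ‖(u : L2 d) x‖ ^ (p + 1) := by
    rw [← integral_const_mul]
    apply integral_congr_ae
    filter_upwards [Lp.coeFn_smul (t : ℂ) (u : L2 d)] with x hx
    rw [Submodule.coe_smul, hx, Pi.smul_apply, smul_eq_mul, norm_mul, Complex.norm_real,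
      Real.norm_of_nonneg ht0.le, Real.mul_rpow ht0.le (norm_nonneg _)]
  refine ⟨(t : ℂ) • u, ?_⟩
  rw [action_eq, h2, h3, h4]
  simp only [hz, Submodule.coe_zero, inner_zero_right, norm_zero, Complex.zero_re]
  have h5 : t ^ (p + 1) = t ^ 2 * t ^ (p - 1) := by
    rw [← Real.rpow_two, ← Real.rpow_add ht0]; congr 1; ring
  have h6 : t ^ (p - 1) * b < a := by
    rw [htp, div_mul_eq_mul_div, div_lt_iff₀ (by positivity)]
    nlinarith
  have h7 : t ^ 2 * (t ^ (p - 1) * b) < t ^ 2 * a := by gcongr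
  have h8 : 2 / (p + 1) * (t ^ (p + 1) * ∫ x, ‖(u : L2 d) x‖ ^ (p + 1))
      = t ^ 2 * (t ^ (p - 1) * b) := by rw [h5, hb]; ring
  rw [h8, ha] at *
  nlinarith

end SubcriticalRotation

theorem action_zero {V : Pt d → ℝ} {p Ω ω : ℝ} (S : SubcriticalRotation V Ω) (hp : 1 < p) :
    action V p Ω ω (0 : L2 d) = 0 := by
  have hz : S.form 0 0 = 0 := by
    have := S.form_smul_left 0 0 0
    simpa using this
  have h := S.action_eq p ω 0
  rw [hz, Submodule.coe_zero] at h
  rw [h]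
  have : ∫ x, ‖(0 : L2 d) x‖ ^ (p + 1) = 0 := by
    rw [integral_eq_zero_of_ae]
    filter_upwards [Lp.coeFn_zero ℂ 2 (volume : Measure (Pt d))] with x hx
    rw [hx]
    simp [Real.zero_rpow (by linarith : p + 1 ≠ 0)]
  rw [this]
  simp

theorem axisDistSq_le (x : Pt d) : axisDistSq x ≤ ‖x‖ ^ 2 := by
  unfold axisDistSq
  split_ifs with h
  · have hjk : (⟨0, by omega⟩ : Fin d) ≠ ⟨1, by omega⟩ := by simp [Fin.ext_iff]
    rw [EuclideanSpace.real_norm_sq_eq, ← Finset.sum_pair (f := fun i => x i ^ 2) hjk]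
    exact Finset.sum_le_sum_of_subset_of_nonneg (Finset.subset_univ _) fun i _ _ => by positivity
  · positivity

/-- Below the critical speed the potential dominates a centrifugal potential. -/
theorem nonempty_subcriticalRotation {V : Pt d → ℝ} (hVm : Measurable V) (hV0 : ∀ x, 0 ≤ V x)
    {Ω : ℝ} (hΩ : ((|Ω| : ℝ) : EReal) < OmegaMax V) : Nonempty (SubcriticalRotation V Ω) := by
  obtain ⟨_, ⟨γ, hγ, rfl, hlim⟩, hlt⟩ := lt_sSup_iff.mp hΩ
  have h1 := hlim.eventually (eventually_ge_atTop 0)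
  obtain ⟨K, hK, hKc⟩ := mem_cocompact.mp h1
  obtain ⟨R, hR⟩ := hK.isBounded.subset_closedBall (0 : Pt d)
  refine ⟨⟨hVm, hV0, γ, γ ^ 2 / 2 * R ^ 2, by exact_mod_cast hlt, by positivity, fun x => ?_⟩⟩
  by_cases hx : x ∈ K
  · have h2 : ‖x‖ ≤ R := by simpa using hR hx
    have h3 : axisDistSq x ≤ R ^ 2 :=
      (axisDistSq_le x).trans (pow_le_pow_left₀ (norm_nonneg _) h2 2)
    have h4 : γ ^ 2 / 2 * axisDistSq x ≤ γ ^ 2 / 2 * R ^ 2 := by gcongr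
    linarith [hV0 x]
  · have h2 : 0 ≤ V x - γ ^ 2 / 2 * axisDistSq x := hKc hx
    have h3 : 0 ≤ γ ^ 2 / 2 * R ^ 2 := by positivity
    linarith

/-- For `ω < -λ₀`, every action ground state minimizes the action over the whole energy space. -/
theorem action_le_of_mem_actionGroundStates {V : Pt d → ℝ} {p Ω ω : ℝ} (S : SubcriticalRotation V Ω)
    (hV : Tendsto V (cocompact (Pt d)) atTop) (hp : 1 < p)
    (hint : ∀ u ∈ H1 d, Integrable (fun x => ‖(u : L2 d) x‖ ^ (p + 1)))
    (hω : ω < -lambda0 V Ω) {φ : L2 d} (hφ : φ ∈ actionGroundStates V p Ω ω) {v : L2 d}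
    (hv : v ∈ X V) : action V p Ω ω φ ≤ action V p Ω ω v := by
  obtain ⟨u, hu⟩ := S.exists_action_le hV hp hint ω
  have hneg : action V p Ω ω (u : L2 d) < 0 := by
    -- `φ` witnesses that the infimum defining `λ₀` is taken over a nonempty set
    obtain ⟨r, ⟨w, hwX, hw0, rfl⟩, hr⟩ := exists_lt_of_csInf_lt
      (s := {r : ℝ | ∃ u ∈ X V, u ≠ 0 ∧ r = linForm V Ω u / ‖u‖ ^ 2})
      ⟨_, φ, hφ.1.1, hφ.1.2.1, rfl⟩ (show lambda0 V Ω < -ω by linarith)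
    have hw : 0 < ‖w‖ ^ 2 := by positivity
    rw [div_lt_iff₀ hw] at hr
    obtain ⟨z, hz⟩ := S.exists_action_neg hp (ω := ω) (u := ⟨w, hwX⟩) (by
      show linForm V Ω w + ω * ‖w‖ ^ 2 < 0
      linarith)
    exact (hu z).trans_lt hz
  have hu0 : (u : L2 d) ≠ 0 := by
    intro h
    rw [h, action_zero S hp] at hneg
    exact lt_irrefl _ hneg
  exact (hφ.2 u ⟨u.2, hu0, S.isStationary_of_minimizer hp hint hu⟩).trans (hu ⟨v, hv⟩)

/-- A global minimizer of the action minimizes the energy at its own mass, because at fixed mass the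
two functionals differ by a constant. -/
theorem mem_energyGroundStates_of_action_le {V : Pt d → ℝ} {p Ω ω : ℝ} {φ : L2 d}
    (hφ0 : φ ≠ 0) (hφX : φ ∈ X V) (h : ∀ v ∈ X V, action V p Ω ω φ ≤ action V p Ω ω v) :
    φ ∈ energyGroundStates V p Ω (‖φ‖ ^ 2) := by
  refine ⟨by positivity, hφX, rfl, fun v hv hvn => ?_⟩
  have := h v hv
  rw [action, action, hvn] at this
  linarith

end Minimization

end RotNLS

end

theorem theorem4p1 (d : ℕ) (hd : 1 ≤ d) (p : ℝ) (hp : 1 < p)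
    (hpd : 3 ≤ d → p < ((d : ℝ) + 2) / ((d : ℝ) - 2))
    (V : EuclideanSpace ℝ (Fin d) → ℝ) (hVmeas : Measurable V) (hV0 : ∀ x, 0 ≤ V x)
    (hV : Filter.Tendsto V (Filter.cocompact (EuclideanSpace ℝ (Fin d))) Filter.atTop)
    (Ω : ℝ) (hΩ0 : 0 < |Ω|) (hΩ : ((|Ω| : ℝ) : EReal) < RotNLS.OmegaMax V)
    (ω : ℝ) (hω : ω < -RotNLS.lambda0 V Ω) :
    (∀ φ ∈ RotNLS.actionGroundStates V p Ω ω,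
      φ ∈ RotNLS.energyGroundStates V p Ω (‖φ‖ ^ 2)) ∧
    (∀ φ ∈ RotNLS.actionGroundStates V p Ω ω,
      ∀ ψ ∈ RotNLS.energyGroundStates V p Ω (‖φ‖ ^ 2),
        ψ ∈ RotNLS.actionGroundStates V p Ω ω) ∧
    RotNLS.actionGroundStates V p Ω ω =
      ⋃ m ∈ RotNLS.actionMasses V p Ω ω, RotNLS.energyGroundStates V p Ω m := by
  obtain ⟨S⟩ := RotNLS.nonempty_subcriticalRotation hVmeas hV0 hΩ
  have hint : ∀ u ∈ RotNLS.H1 d, Integrable (fun x => ‖(u : RotNLS.L2 d) x‖ ^ (p + 1)) :=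
    fun u hu => RotNLS.integrable_rpow_of_subcritical hp hpd hu
  have hmin : ∀ φ ∈ RotNLS.actionGroundStates V p Ω ω, ∀ v ∈ RotNLS.X V,
      RotNLS.action V p Ω ω φ ≤ RotNLS.action V p Ω ω v := fun φ hφ v hv =>
    RotNLS.action_le_of_mem_actionGroundStates S hV hp hint hω hφ hv
  have h1 : ∀ φ ∈ RotNLS.actionGroundStates V p Ω ω,
      φ ∈ RotNLS.energyGroundStates V p Ω (‖φ‖ ^ 2) := fun φ hφ =>
    RotNLS.mem_energyGroundStates_of_action_le hφ.1.2.1 hφ.1.1 (hmin φ hφ)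
  have h2 : ∀ φ ∈ RotNLS.actionGroundStates V p Ω ω,
      ∀ ψ ∈ RotNLS.energyGroundStates V p Ω (‖φ‖ ^ 2),
        ψ ∈ RotNLS.actionGroundStates V p Ω ω := by
    intro φ hφ ψ ⟨hm, hψX, hψm, hψE⟩
    -- `ψ` has the mass and at most the energy of `φ`, hence at most its action
    have hle : RotNLS.action V p Ω ω ψ ≤ RotNLS.action V p Ω ω φ := by
      have := hψE φ hφ.1.1 rfl
      rw [RotNLS.action, RotNLS.action, hψm]
      linarith
    have hψmin : ∀ v ∈ RotNLS.X V, RotNLS.action V p Ω ω ψ ≤ RotNLS.action V p Ω ω v :=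
      fun v hv => hle.trans (hmin φ hφ v hv)
    have hψ0 : ψ ≠ 0 := by
      rintro rfl
      rw [← hψm] at hm
      simp at hm
    exact ⟨⟨hψX, hψ0, S.isStationary_of_minimizer (u := ⟨ψ, hψX⟩) hp hint
      fun v => hψmin v v.2⟩, fun v hv => hψmin v hv.1⟩
  refine ⟨h1, h2, Set.Subset.antisymm (fun φ hφ => ?_) fun ψ hψ => ?_⟩
  · exact Set.mem_biUnion (x := ‖φ‖ ^ 2) ⟨φ, hφ, rfl⟩ (h1 φ hφ)
  · obtain ⟨m, ⟨φ, hφ, rfl⟩, hψm⟩ := Set.mem_iUnion₂.mp hψ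
    exact h2 φ hφ ψ hψm
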